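/- **Setting.** An $n$-legged spider mechanism ($n\ge 1$) in $\mathbb{R}^2$ consists of pairwise distinct feet $A_1,\dots,A_n$, integers $p_i>1$ and edge lengths $\ell_{i,j}>0$ ($1\le j\le p_i$). Its spider space $\mathcal S\subset(\mathbb{R}^2)^{1+N}$, $N=\sum_i(p_i-1)$, is the set of all $\xi=(X,(A_i^j)_{1\le i\le n,\,1\le j<p_i})$ such that, with $A_i^0=A_i$ and $A_i^{p_i}=X$, $|A_i^{j-1}A_i^{j}|=\ell_{i,j}$ for all $i$ and $1\le j\le p_i$. Put $\pi(\xi)=X$ and $\mathcal W=\pi(\mathcal S)$. The leg $i$ of $\xi$ is *aligned* if $A_i^0,\dots,A_i^{p_i}$ lie on one line. The *critical circles* of the foot $A_i$ are $C(A_i,r_i^{\epsilon})=\{x: |xA_i|=r_i^{\epsilon}\}$ with $r_i^{\epsilon}=|\sum_j\epsilon_j\ell_{i,j}|$, $\epsilon\in\{-1,1\}^{p_i}$ (a point if $r_i^\epsilon=0$). Let $V(x)=\min_i\|x-a_i\|^2$ on $\mathbb{R}^2$ and $\mathbb V=V\circ\pi$ on $\mathcal S$. Let $\mathcal V$ be the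 Voronoi diagram, i.e. the set of points $x$ with $V(x)=\|x-a_i\|^2=\|x-a_j\|^2$ for some $i\ne j$; let $P(A_i)=\{x:\|x-a_i\|^2\le V(x)\}$ and let $P^\circ(A_i)$ be its interior. For a locally Lipschitz function $h$ on a submanifold $M$ of a Euclidean space, the Clarke subdifferential $\partial h(a)$ is the convex hull of all limits of tangential gradients $\nabla h(x_\nu)\in T_{x_\nu}M$ with $x_\nu\in M$ points of differentiability of $h$, $x_\nu\to a$; $a$ is *critical* if $0\in\partial h(a)$. For $X\neq A_i,A_j$, let $\langle A_iXA_j\rangle$ be the closed double cone with apex $X$ over the angle $\angle A_iXA_j$, i.e. $\{X\pm(s\,\overrightarrow{XA_i}+t\,\overrightarrow{XA_j}): s,t\ge0\}$. The mechanism is *strongly Voronoi-generic* if: no configuration in $\mathcal S$ has more than two aligned legs, and two aligned legs of a configuration are never parallel (so $\mathcal S$ is smooth); no critical point of $V$ lies on a critical circle; no critical point $x$ of $V$ is the centre of a circle that passes through at least four feet and has no foot in its interior; no $\xi\in\mathcal S$ with $\pi(\xi)\in\mathcal V$ has two aligned legs. **Theorem.** For a strongly Voronoi-generic spider mechanism,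 a configuration $\xi\in\mathcal S$ with $X=\pi(\xi)$ is critical for $\mathbb V$ if and only if one of the following holds: 1. no leg of $\xi$ is aligned and $X$ is a critical point of $V$; 2. exactly one leg of $\xi$, the leg $k$, is aligned, and - (a) $X\in P^\circ(A_i)$ for some $i$, where either $i\ne k$ and $X$ is a point of the intersection of a critical circle $C(A_k,r_k^{\epsilon})$, the line $A_iA_k$ and $\mathcal W$, or $i=k$ and $X$ lies on a critical circle $C(A_k,r_k^\epsilon)$; or - (b) $X\in\mathcal V$, and there are $i\ne j$ with $X\in P(A_i)\cap P(A_j)$ such that the line $XA_k$ is contained in $\langle A_iXA_j\rangle$ (this holds in particular if $k\in\{i,j\}$); 3. exactly two legs $k\ne l$ of $\xi$ are aligned, and $X$ is a point of intersection of critical circles of $A_k$ and $A_l$. -/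

import Mathlib

open Filter Topology

noncomputable section

/-! ### Clarke subdifferential of a function on a submanifold of a Euclidean space -/

/-- The tangent space `T_x M` of a subset `M` at `x`: the linear span of the tangent cone. For a
`C¹` submanifold this is the usual tangent space, and for `M = univ` it is the whole space. -/
def tangentSpaceAt {E : Type*} [NormedAddCommGroup E] [InnerProductSpace ℝ E]
    (M : Set E) (x : E) : Submodule ℝ E :=
  Submodule.span ℝ (tangentConeAt ℝ M x)

/-- `v` is the tangential gradient of `h` along `M` at `x`: `v ∈ T_x M` and
`h x' = h x + ⟪v, x' - x⟫ + o(‖x' - x‖)` as `x' → x` in `M`.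
As `v` is tangent, `⟪v, x' - x⟫ = ⟪v, ρ (x' - x)⟫` for the orthogonal projection `ρ` to `T_x M`. -/
def HasTangentialGradientAt {E : Type*} [NormedAddCommGroup E] [InnerProductSpace ℝ E]
    [CompleteSpace E] (M : Set E) (h : E → ℝ) (v x : E) : Prop :=
  v ∈ tangentSpaceAt M x ∧ HasGradientWithinAt h v M x

/-- Limits of tangential gradients `∇h(x_ν)` at points `x_ν ∈ M` of differentiability
that converge to `a`. -/
def limitingGradients {E : Type*} [NormedAddCommGroup E] [InnerProductSpace ℝ E]
    [CompleteSpace E] (M : Set E) (h : E → ℝ) (a : E) : Set E :=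
  {v | ∃ x w : ℕ → E, (∀ ν, x ν ∈ M ∧ HasTangentialGradientAt M h (w ν) (x ν)) ∧
    Tendsto x atTop (𝓝 a) ∧ Tendsto w atTop (𝓝 v)}

/-- The Clarke subdifferential `∂h(a)` of a locally Lipschitz function `h` on `M`. -/
def clarkeSubdifferential {E : Type*} [NormedAddCommGroup E] [InnerProductSpace ℝ E]
    [CompleteSpace E] (M : Set E) (h : E → ℝ) (a : E) : Set E :=
  convexHull ℝ (limitingGradients M h a)

/-- `a` is a critical point of `h` on `M` in the sense of Clarke. -/
def IsClarkeCritical {E : Type*} [NormedAddCommGroup E] [InnerProductSpace ℝ E]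
    [CompleteSpace E] (M : Set E) (h : E → ℝ) (a : E) : Prop :=
  0 ∈ clarkeSubdifferential M h a

/-! ### Planar spiders -/

/-- The Euclidean plane. -/
abbrev Plane : Type := EuclideanSpace ℝ (Fin 2)

/-- The closed double cone with apex `x` over the angle `∠ a x b`: all points `x + v` for which
`v` or `-v` is a combination of `a - x` and `b - x` with nonnegative coefficients. -/
def doubleCone (x a b : Plane) : Set Plane :=
  {y | ∃ s t : ℝ, 0 ≤ s ∧ 0 ≤ t ∧
    (y - x = s • (a - x) + t • (b - x) ∨ -(y - x) = s • (a - x) + t • (b - x))}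

/-- An `n`-legged spider mechanism in the plane; `length i j` is the length of the edge of
the leg `i` that joins its `j`-th and its `(j+1)`-st node. -/
structure SpiderMechanism (n : ℕ) where
  foot : Fin n → Plane
  foot_injective : Function.Injective foot
  numEdges : Fin n → ℕ
  one_lt_numEdges : ∀ i, 1 < numEdges i
  length : (i : Fin n) → Fin (numEdges i) → ℝ
  length_pos : ∀ i j, 0 < length i j

namespace SpiderMechanism

variable {n : ℕ} (M : SpiderMechanism n)

/-- The ambient Euclidean space `(ℝ²)^(1+N)`, `N = ∑ i, (p i - 1)`: one coordinate `none`
for the body, and one coordinate for each joint of each leg. -/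
abbrev Ambient : Type :=
  PiLp 2 (fun _ : Option (Σ i : Fin n, Fin (M.numEdges i - 1)) => Plane)

/-- The work map: the body of a configuration. -/
def body (ξ : M.Ambient) : Plane := ξ none

/-- The nodes of the leg `i`: the foot for `j = 0`, the joints for `0 < j < p i`,
the body for `j = p i`. -/
def node (ξ : M.Ambient) (i : Fin n) (j : ℕ) : Plane :=
  if j = 0 then M.foot i
  else if h : j - 1 < M.numEdges i - 1 then ξ (some ⟨i, ⟨j - 1, h⟩⟩)
  else M.body ξ

/-- The spider space. -/
def spiderSpace : Set M.Ambient :=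
  {ξ | ∀ (i : Fin n) (j : Fin (M.numEdges i)),
    dist (M.node ξ i j) (M.node ξ i (j + 1)) = M.length i j}

/-- The work space. -/
def workSpace : Set Plane := M.body '' M.spiderSpace

/-- All the nodes of the leg `i`, from its foot to the body. -/
def legNodes (ξ : M.Ambient) (i : Fin n) : Set Plane :=
  M.node ξ i '' {j | j ≤ M.numEdges i}

/-- The leg `i` is aligned: it fits in a straight line. -/
def IsAligned (ξ : M.Ambient) (i : Fin n) : Prop := Collinear ℝ (M.legNodes ξ i)

/-- The critical radius `|∑ j, ε j * ℓ i j|` of the leg `i`. -/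
def criticalRadius (i : Fin n) (ε : Fin (M.numEdges i) → ℤˣ) : ℝ :=
  |∑ j, ((ε j : ℤ) : ℝ) * M.length i j|

/-- The critical circle about the foot `i` (a point when the radius vanishes). -/
def criticalCircle (i : Fin n) (ε : Fin (M.numEdges i) → ℤˣ) : Set Plane :=
  {x | ‖x - M.foot i‖ = M.criticalRadius i ε}

/-- The (squared) Voronoi distance `V`. -/
def voronoiDist (x : Plane) : ℝ := ⨅ i : Fin n, ‖x - M.foot i‖ ^ 2

/-- The lifted Voronoi distance `𝕍 = V ∘ π`. -/
def liftedVoronoiDist (ξ : M.Ambient) : ℝ := M.voronoiDist (M.body ξ)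

/-- The Voronoi diagram of the feet. -/
def voronoiDiagram : Set Plane :=
  {x | ∃ i j : Fin n, i ≠ j ∧
    M.voronoiDist x = ‖x - M.foot i‖ ^ 2 ∧ M.voronoiDist x = ‖x - M.foot j‖ ^ 2}

/-- The power cell `P(A_i)`; its open part is `interior (M.powerCell i)`. -/
def powerCell (i : Fin n) : Set Plane := {x | ‖x - M.foot i‖ ^ 2 ≤ M.voronoiDist x}

/-- The `k`-th void circle property of `y`: some circle about `y` passes through (at least) `k`
feet and has no foot in its interior. -/
def HasVoidCircle (k : ℕ) (y : Plane) : Prop :=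
  ∃ (r : ℝ) (s : Finset (Fin n)), s.card = k ∧
    (∀ i ∈ s, dist y (M.foot i) = r) ∧ ∀ i, r ≤ dist y (M.foot i)

/-- `x` is a critical point of the Voronoi distance `V` on the plane. -/
def IsVoronoiCritical (x : Plane) : Prop := IsClarkeCritical Set.univ M.voronoiDist x

/-- `ξ` is a critical point of `𝕍` on the spider space. -/
def IsLiftedVoronoiCritical (ξ : M.Ambient) : Prop :=
  IsClarkeCritical M.spiderSpace M.liftedVoronoiDist ξ

/-- Strong Voronoi genericity of a spider mechanism. The first two clauses are the smoothness
conditions for the spider space. -/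
structure StronglyVoronoiGeneric : Prop where
  /-- No configuration has more than two aligned legs. -/
  aligned_le_two : ∀ ξ ∈ M.spiderSpace, {i | M.IsAligned ξ i}.ncard ≤ 2
  /-- Two aligned legs are never parallel. -/
  not_parallel : ∀ ξ ∈ M.spiderSpace, ∀ i j, i ≠ j → M.IsAligned ξ i → M.IsAligned ξ j →
    ¬ (affineSpan ℝ (M.legNodes ξ i)).Parallel (affineSpan ℝ (M.legNodes ξ j))
  /-- Critical points of `V` do not lie on critical circles. -/
  critical_notMem_circle : ∀ x, M.IsVoronoiCritical x → ∀ i ε, x ∉ M.criticalCircle i ε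
  /-- There are no critical points of `V` with the fourth void circle property. -/
  no_four_void : ∀ x, M.IsVoronoiCritical x → ¬ M.HasVoidCircle 4 x
  /-- There are no two aligned legs over the Voronoi diagram. -/
  no_two_aligned : ∀ ξ ∈ M.spiderSpace, M.body ξ ∈ M.voronoiDiagram →
    ∀ i j, M.IsAligned ξ i → M.IsAligned ξ j → i = j

end SpiderMechanism

end

/-!
The spider space is a level set of the squared edge lengths. A linear relation between their
differentials at a configuration is a system of edge tensions in equilibrium at all joints and at
the body. Equilibrium at the joints of a leg means that the tension forces of its edges all agree;
the common force is called a *stress* of the leg. A leg has a nonzero stress exactly when it is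
aligned, and then its stresses are the vectors along it
(`SpiderMechanism.isAligned_iff_exists_stress`). As at most two legs are aligned, and two aligned
legs are not parallel, stresses that cancel at the body vanish, and the spider space is a regular
level set (`SpiderMechanism.StronglyVoronoiGeneric.isRegularLevelSet`).

For a minimum of finitely many `C¹` functions on a regular level set, a point is Clarke critical if
and only if some convex combination of the active gradients is normal to the level set
(`IsRegularLevelSet.isClarkeCritical_iInf_iff`). One direction is that every limiting gradient is
the tangential part of an active gradient. In general not every active gradient contributes one,
since the level set may avoid the region where it is active: the work map folds at an aligned leg.
But for each tangent direction `τ`, points of the level set that approach along `τ` produce a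
limiting gradient whose slope along `τ` is minimal among the active ones; if `0` were separated by
`τ` from the convex hull of the limiting gradients, all active gradients would have positive slope
along `τ`, and no convex combination of them could be normal.

Hence a configuration is critical if and only if a convex combination of the vectors from the
nearest feet to the body is a sum of stresses
(`SpiderMechanism.StronglyVoronoiGeneric.isLiftedVoronoiCritical_iff`). Without aligned legs this
says that `0` is such a combination, that is, that the body is critical for the Voronoi distance.
Two stresses that are not parallel produce every vector. With one aligned leg, genericity excludes
that `0` is such a combination, and the condition becomes that the line from the body to the foot of
this leg meets the convex hull of the nearest feet: it passes through the only nearest foot, or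
it weakly separates two nearest feet and therefore runs in their double cone.
-/

noncomputable section

/-! ### Regular level sets -/

/-- `S` is empty or a level set of `F`, all of whose points are regular: `F` is strictly
differentiable with continuous derivative `F'`, and `F'` is onto at the points of `S`. -/
structure IsRegularLevelSet {E G : Type*} [NormedAddCommGroup E] [NormedSpace ℝ E]
    [NormedAddCommGroup G] [NormedSpace ℝ G] (S : Set E) (F : E → G) (F' : E → E →L[ℝ] G) :
    Prop where
  hasStrictFDerivAt : ∀ x, HasStrictFDerivAt F (F' x) x
  continuous_deriv : Continuous F'
  range_eq_top : ∀ x ∈ S, (F' x).range = ⊤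
  mem_iff : ∀ x ∈ S, ∀ y, y ∈ S ↔ F y = F x

namespace IsRegularLevelSet

section
variable {E G : Type*} [NormedAddCommGroup E] [NormedSpace ℝ E] [CompleteSpace E]
  [NormedAddCommGroup G] [NormedSpace ℝ G] [FiniteDimensional ℝ G]
  {S : Set E} {F : E → G} {F' : E → E →L[ℝ] G}

omit [CompleteSpace E] [FiniteDimensional ℝ G] in
theorem isClosed (h : IsRegularLevelSet S F F') :
    IsClosed S := by
  obtain rfl | ⟨a, ha⟩ := S.eq_empty_or_nonempty
  · exact isClosed_empty
  have hS : S = F ⁻¹' {F a} := Set.ext (h.mem_iff a ha)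
  have hF : Continuous F :=
    continuous_iff_continuousAt.2 fun x => (h.hasStrictFDerivAt x).continuousAt
  rw [hS]
  exact isClosed_singleton.preimage hF

/-- The implicit function theorem provides a curve in `S` with any given velocity in the kernel. -/
theorem exists_curve (h : IsRegularLevelSet S F F') {a τ : E} (ha : a ∈ S) (hτ : F' a τ = 0) :
    ∃ γ : ℝ → E, γ 0 = a ∧ HasDerivAt γ τ 0 ∧ ∀ᶠ t in 𝓝 0, γ t ∈ S := by
  have hs := h.hasStrictFDerivAt a
  have hr := h.range_eq_top a ha
  let v : (F' a).ker := ⟨τ, hτ⟩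
  have hline : HasDerivAt (fun t : ℝ => t • v) v 0 := by
    simpa using (hasDerivAt_id (0 : ℝ)).smul_const v
  have hline0 : Tendsto (fun t : ℝ => t • v) (𝓝 0) (𝓝 0) := by
    simpa using hline.continuousAt.tendsto
  refine ⟨fun t => hs.implicitFunction F (F' a) hr (F a) (t • v), by simp, ?_, ?_⟩
  · have h1 := (hs.to_implicitFunction hr).hasFDerivAt
    have h2 := HasFDerivAt.comp_hasDerivAt_of_eq (0 : ℝ) h1 hline (by simp)
    simpa [Function.comp_def, v] using h2
  · have h3 : Tendsto (fun t : ℝ => (F a, t • v)) (𝓝 0) (𝓝 (F a, 0)) :=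
      tendsto_const_nhds.prodMk_nhds hline0
    filter_upwards [h3.eventually (hs.map_implicitFunction_eq hr)] with t ht
    exact (h.mem_iff a ha _).2 ht

theorem mem_posTangentConeAt (h : IsRegularLevelSet S F F') {a τ : E} (ha : a ∈ S)
    (hτ : F' a τ = 0) : τ ∈ posTangentConeAt S a := by
  obtain ⟨γ, h0, hd, hS⟩ := h.exists_curve ha hτ
  have hd' : Tendsto (fun t => γ t - a) (𝓝[>] (0 : ℝ)) (𝓝 0) := by
    have := hd.continuousAt.tendsto.sub_const a
    rw [h0, sub_self] at this
    exact this.mono_left nhdsWithin_le_nhds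
  refine mem_tangentConeAt_of_seq (𝓝[>] (0 : ℝ)) (fun t => (t⁻¹).toNNReal)
    (fun t => γ t - a) hd' ?_ ?_
  · filter_upwards [nhdsWithin_le_nhds hS] with t ht
    simpa using ht
  · have h2 := (hasDerivAt_iff_tendsto_slope_zero.1 hd).mono_left
      (nhdsWithin_mono _ (show Set.Ioi (0 : ℝ) ⊆ {0}ᶜ from fun t ht => ne_of_gt ht))
    refine h2.congr' ?_
    filter_upwards [self_mem_nhdsWithin] with t ht
    rw [zero_add, h0, NNReal.smul_def, Real.coe_toNNReal _ (inv_nonneg.2 (le_of_lt ht))]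

theorem tangentConeAt_eq (h : IsRegularLevelSet S F F') {a : E} (ha : a ∈ S) :
    tangentConeAt ℝ S a = (F' a).ker := by
  refine Set.Subset.antisymm ?_ fun τ hτ => tangentConeAt_mono_field (h.mem_posTangentConeAt ha hτ)
  intro τ hτ
  obtain ⟨α, l, hl, c, d, hd0, hd, hcd⟩ := exists_fun_of_mem_tangentConeAt hτ
  have h1 := (h.hasStrictFDerivAt a).hasFDerivAt.hasFDerivWithinAt.lim hd0 hd hcd
  have h2 : (fun n => c n • (F (a + d n) - F a)) =ᶠ[l] fun _ => 0 := by
    filter_upwards [hd] with n hn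
    rw [(h.mem_iff a ha _).1 hn, sub_self, smul_zero]
  exact tendsto_nhds_unique (h1.congr' h2) tendsto_const_nhds

omit [CompleteSpace E] in
/-- The kernels vary lower semicontinuously: with a right inverse `R` of `F' a`, the corrections
`R (F' x ∘ R)⁻¹ (F' x τ)` move `τ` into the kernels of `F' x` and tend to `0`. -/
theorem exists_tendsto_ker (h : IsRegularLevelSet S F F') {a τ : E} (ha : a ∈ S)
    (hτ : F' a τ = 0) {x : ℕ → E} (hx : Tendsto x atTop (𝓝 a)) :
    ∃ σ : ℕ → E, Tendsto σ atTop (𝓝 τ) ∧ ∀ᶠ n in atTop, F' (x n) (σ n) = 0 := by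
  have := FiniteDimensional.complete ℝ G
  obtain ⟨R, hR⟩ := (F' a).exists_rightInverse_of_surjective (h.range_eq_top a ha)
  have hA : Tendsto (fun n => F' (x n)) atTop (𝓝 (F' a)) :=
    (h.continuous_deriv.tendsto a).comp hx
  have hB : Tendsto (fun n => (F' (x n)).comp R) atTop (𝓝 (1 : G →L[ℝ] G)) := by
    have : (F' a).comp R = 1 := hR
    rw [← this]
    exact ((ContinuousLinearMap.compL ℝ G E G).flip R).continuous.continuousAt.tendsto.comp hA
  have hinv : Tendsto (fun n => Ring.inverse ((F' (x n)).comp R)) atTop (𝓝 (1 : G →L[ℝ] G)) := by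
    have := (NormedRing.inverse_continuousAt (1 : (G →L[ℝ] G)ˣ)).tendsto.comp hB
    simpa [Function.comp_def] using this
  refine ⟨fun n => τ - R (Ring.inverse ((F' (x n)).comp R) (F' (x n) τ)), ?_, ?_⟩
  · have h1 : Tendsto (fun n => F' (x n) τ) atTop (𝓝 0) := by
      simpa [hτ, Function.comp_def] using
      (isBoundedBilinearMap_apply.continuous.tendsto (F' a, τ)).comp
        (hA.prodMk_nhds tendsto_const_nhds)
    have h2 := (R.continuous.tendsto _).comp
      ((isBoundedBilinearMap_apply.continuous.tendsto ((1 : G →L[ℝ] G), (0 : G))).comp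
        (hinv.prodMk_nhds h1))
    simpa [Function.comp_def] using tendsto_const_nhds.sub h2
  · have hu := hB.eventually (Units.isOpen.mem_nhds (isUnit_one (M := G →L[ℝ] G)))
    filter_upwards [hu] with n hn
    have := congrArg (fun T : G →L[ℝ] G => T (F' (x n) τ)) (Ring.mul_inverse_cancel _ hn)
    rw [map_sub, sub_eq_zero]
    exact this.symm

end

end IsRegularLevelSet

/-! ### Clarke critical points of a minimum of smooth functions -/

theorem exists_strictMono_comp_eq_const {ι : Type*} [Finite ι] (u : ℕ → ι) :
    ∃ (i : ι) (φ : ℕ → ℕ), StrictMono φ ∧ ∀ n, u (φ n) = i := by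
  obtain ⟨i, hi⟩ := Finite.exists_infinite_fiber u
  have hf : ∃ᶠ n in atTop, u n = i :=
    Nat.frequently_atTop_iff_infinite.2 (Set.infinite_coe_iff.1 hi)
  obtain ⟨φ, hφ, h⟩ := extraction_of_frequently_atTop hf
  exact ⟨i, φ, hφ, h⟩

theorem continuous_iInf_of_finite {X ι : Type*} [TopologicalSpace X] [Finite ι] [Nonempty ι]
    {g : ι → X → ℝ} (hg : ∀ i, Continuous (g i)) : Continuous fun x => ⨅ i, g i x := by
  have := Fintype.ofFinite ι
  have : (fun x => ⨅ i, g i x) =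
      fun x => Finset.univ.inf' Finset.univ_nonempty fun i => g i x := by
    ext x
    rw [Finset.inf'_univ_eq_ciInf]
  rw [this]
  exact Continuous.finset_inf'_apply Finset.univ_nonempty fun i _ => hg i

/-- Near every point of a closed set there are points of it around which one and the same member
of a finite family attains the minimum. -/
theorem exists_eventually_eq_iInf {E ι : Type*} [MetricSpace E] [CompleteSpace E] [Finite ι]
    [Nonempty ι] {g : ι → E → ℝ} {S : Set E} (hS : IsClosed S)
    (hg : ∀ i, Continuous (g i)) {x : E} (hx : x ∈ S) {ε : ℝ} (hε : 0 < ε) :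
    ∃ y ∈ S, dist y x < ε ∧ ∃ i, ∀ᶠ z in 𝓝[S] y, ⨅ j, g j z = g i z := by
  have := hS.completeSpace_coe
  let C : ι → Set S := fun i => {z | ⨅ j, g j z = g i z}
  have hC : ∀ i, IsClosed (C i) := fun i =>
    isClosed_eq ((continuous_iInf_of_finite hg).comp continuous_subtype_val)
      ((hg i).comp continuous_subtype_val)
  have hU : ⋃ i, C i = Set.univ := Set.eq_univ_of_forall fun z => by
    obtain ⟨i, hi⟩ := exists_eq_ciInf_of_finite (f := fun j => g j (z : E))
    exact Set.mem_iUnion.2 ⟨i, hi.symm⟩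
  obtain ⟨y, hy, hyx⟩ := (dense_iUnion_interior_of_closed hC hU).exists_dist_lt ⟨x, hx⟩ hε
  obtain ⟨i, hi⟩ := Set.mem_iUnion.1 hy
  refine ⟨y, y.2, by rwa [dist_comm] at hyx, i, ?_⟩
  exact (eventually_nhds_subtype_iff S y fun z => ⨅ j, g j z = g i z).1
    (mem_interior_iff_mem_nhds.1 hi)

namespace IsRegularLevelSet

variable {E G : Type*} [NormedAddCommGroup E] [InnerProductSpace ℝ E] [FiniteDimensional ℝ E]
  [CompleteSpace E] [NormedAddCommGroup G] [NormedSpace ℝ G] [FiniteDimensional ℝ G]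
  {S : Set E} {F : E → G} {F' : E → E →L[ℝ] G}

omit [FiniteDimensional ℝ E] in
theorem tangentSpaceAt_eq (h : IsRegularLevelSet S F F') {a : E} (ha : a ∈ S) :
    tangentSpaceAt S a = (F' a).ker := by
  rw [tangentSpaceAt, h.tangentConeAt_eq ha]
  exact Submodule.span_eq _

omit [FiniteDimensional ℝ E] in
/-- Along `S`, the gradient of an ambient function is projected to the tangent space. -/
theorem hasTangentialGradientAt_starProjection (h : IsRegularLevelSet S F F') {a v : E}
    (ha : a ∈ S) {g : E → ℝ} (hg : HasGradientAt g v a) :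
    HasTangentialGradientAt S g ((F' a).ker.starProjection v) a := by
  refine ⟨?_, ?_⟩
  · rw [h.tangentSpaceAt_eq ha]
    exact Submodule.starProjection_apply_mem _ _
  set w := (F' a).ker.starProjection v with hw
  obtain ⟨R, hR⟩ := (F' a).exists_rightInverse_of_surjective (h.range_eq_top a ha)
  -- the normal component `v - w` is the gradient of a function `φ ∘ F`, constant along `S`
  let φ : G →L[ℝ] ℝ := (InnerProductSpace.toDual ℝ E (v - w)).comp R
  have hφ : φ.comp (F' a) = InnerProductSpace.toDual ℝ E (v - w) := by
    ext x
    have hk : x - R (F' a x) ∈ (F' a).ker := by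
      have := congrArg (fun T : G →L[ℝ] G => T (F' a x)) hR
      simp only [ContinuousLinearMap.comp_apply, ContinuousLinearMap.id_apply] at this
      simp [this]
    have h0 := (Submodule.mem_orthogonal' _ _).1
      ((F' a).ker.sub_starProjection_mem_orthogonal v) _ hk
    rw [← hw, inner_sub_right, sub_eq_zero] at h0
    simpa only [φ, ContinuousLinearMap.comp_apply, InnerProductSpace.toDual_apply_apply]
      using h0.symm
  have h1 := hg.hasFDerivAt.sub (φ.hasFDerivAt.comp a (h.hasStrictFDerivAt a).hasFDerivAt)
  rw [hφ, ← map_sub, sub_sub_cancel] at h1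
  have h2 := (h1.add_const (φ (F a))).hasFDerivWithinAt (s := S)
  refine HasFDerivWithinAt.congr h2 (fun x hx => ?_) ?_
  · simp [(h.mem_iff a ha x).1 hx]
  · simp

omit [FiniteDimensional ℝ E] in
/-- A function touching `k` from above at `a` has the same derivative along `S`. -/
theorem inner_eq_of_le (h : IsRegularLevelSet S F F') {a v w : E} (ha : a ∈ S) {g k : E → ℝ}
    (hg : HasGradientAt g v a) (hk : HasTangentialGradientAt S k w a) (hle : ∀ x ∈ S, k x ≤ g x)
    (heq : g a = k a) {τ : E} (hτ : F' a τ = 0) : inner ℝ w τ = inner ℝ v τ := by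
  have hd : HasFDerivWithinAt (fun x => g x - k x)
      (InnerProductSpace.toDual ℝ E v - InnerProductSpace.toDual ℝ E w) S a :=
    hg.hasFDerivAt.hasFDerivWithinAt.sub hk.2.hasFDerivWithinAt
  have hmin : IsLocalMinOn (fun x => g x - k x) S a := by
    filter_upwards [self_mem_nhdsWithin] with x hx
    rw [heq, sub_self]
    exact sub_nonneg.2 (hle x hx)
  have := hmin.hasFDerivWithinAt_eq_zero hd (h.mem_posTangentConeAt ha hτ)
    (h.mem_posTangentConeAt ha (by simp [hτ]))
  simp only [sub_apply, InnerProductSpace.toDual_apply_apply] at this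
  linarith

/-- The projections to the tangent spaces depend continuously on the point. -/
theorem tendsto_starProjection (h : IsRegularLevelSet S F F') {a v : E} (ha : a ∈ S) {x u : ℕ → E}
    (hx : Tendsto x atTop (𝓝 a)) (hu : Tendsto u atTop (𝓝 v)) :
    Tendsto (fun n => (F' (x n)).ker.starProjection (u n)) atTop
      (𝓝 ((F' a).ker.starProjection v)) := by
  refine tendsto_of_subseq_tendsto fun ns hns => ?_
  have hx1 := hx.comp hns
  have hu1 := hu.comp hns
  have hb : ∃ᶠ n in atTop, (F' (x (ns n))).ker.starProjection (u (ns n)) ∈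
      Metric.closedBall (0 : E) (‖v‖ + 1) := by
    refine Eventually.frequently ?_
    filter_upwards [hu1.norm.eventually (gt_mem_nhds (lt_add_one ‖v‖))] with n hn
    rw [mem_closedBall_zero_iff]
    exact ((F' (x (ns n))).ker.norm_starProjection_apply_le _).trans hn.le
  obtain ⟨w, -, φ, hφ, hw⟩ := tendsto_subseq_of_frequently_bounded Metric.isBounded_closedBall hb
  refine ⟨φ, ?_⟩
  have hx2 := hx1.comp hφ.tendsto_atTop
  have hu2 := hu1.comp hφ.tendsto_atTop
  suffices hPw : (F' a).ker.starProjection v = w by rwa [hPw]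
  refine Submodule.eq_starProjection_of_mem_of_inner_eq_zero ?_ fun τ hτ => ?_
  · have h1 := (isBoundedBilinearMap_apply.continuous.tendsto (F' a, w)).comp
      (((h.continuous_deriv.tendsto a).comp hx2).prodMk_nhds hw)
    refine tendsto_nhds_unique h1 (tendsto_const_nhds.congr fun n => ?_)
    exact (LinearMap.mem_ker.1 (Submodule.starProjection_apply_mem (F' (x (ns (φ n)))).ker _)).symm
  · obtain ⟨σ, hσ, hσ0⟩ := h.exists_tendsto_ker ha hτ hx2
    refine tendsto_nhds_unique ((hu2.sub hw).inner hσ) (tendsto_const_nhds.congr' ?_)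
    filter_upwards [hσ0] with n hn
    exact (Submodule.starProjection_inner_eq_zero _ _ hn).symm

variable {ι : Type*} [Finite ι] [Nonempty ι] {g : ι → E → ℝ} {g' : ι → E → E}

/-- Every limiting gradient of a minimum is the tangential part of an active gradient. -/
theorem eq_starProjection_of_mem_limitingGradients (h : IsRegularLevelSet S F F')
    (hg : ∀ i x, HasGradientAt (g i) (g' i x) x) (hg' : ∀ i, Continuous (g' i)) {a w : E}
    (ha : a ∈ S) (hw : w ∈ limitingGradients S (fun x => ⨅ i, g i x) a) :
    ∃ i, g i a = ⨅ j, g j a ∧ w = (F' a).ker.starProjection (g' i a) := by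
  obtain ⟨x, u, hxu, hx, hu⟩ := hw
  choose i hi using fun n => exists_eq_ciInf_of_finite (f := fun j => g j (x n))
  obtain ⟨j, φ, hφ, hj⟩ := exists_strictMono_comp_eq_const i
  have hx' := hx.comp hφ.tendsto_atTop
  have hgc : ∀ i, Continuous (g i) := fun i =>
    continuous_iff_continuousAt.2 fun x => (hg i x).continuousAt
  have hact : ∀ n, g j (x (φ n)) = ⨅ k, g k (x (φ n)) := fun n => by
    have := hi (φ n)
    rwa [hj n] at this
  refine ⟨j, tendsto_nhds_unique (((hgc j).tendsto a).comp hx') ?_, ?_⟩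
  · refine (((continuous_iInf_of_finite hgc).tendsto a).comp hx').congr fun n => ?_
    exact (hact n).symm
  · refine tendsto_nhds_unique (hu.comp hφ.tendsto_atTop)
      ((h.tendsto_starProjection ha hx' (((hg' j).tendsto a).comp hx')).congr fun n => ?_)
    obtain ⟨hS, hgrad⟩ := hxu (φ n)
    refine Submodule.eq_starProjection_of_mem_of_inner_eq_zero ?_ fun τ hτ => ?_
    · exact h.tangentSpaceAt_eq hS ▸ hgrad.1
    · rw [inner_sub_left, sub_eq_zero]
      exact (h.inner_eq_of_le hS (hg j _) hgrad
        (fun y _ => ciInf_le (Set.finite_range fun k => g k y).bddBelow j) (hact n) hτ).symm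

/-- For every tangent direction `τ`, some active gradient whose slope along `τ` is the smallest
among the active ones contributes a limiting gradient. -/
theorem exists_mem_limitingGradients (h : IsRegularLevelSet S F F')
    (hg : ∀ i x, HasGradientAt (g i) (g' i x) x) (hg' : ∀ i, Continuous (g' i)) {a τ : E}
    (ha : a ∈ S) (hτ : F' a τ = 0) :
    ∃ w ∈ limitingGradients S (fun x => ⨅ i, g i x) a, ∀ j, g j a = ⨅ k, g k a →
      inner ℝ w τ ≤ inner ℝ (g' j a) τ := by
  have hgc : ∀ i, Continuous (g i) := fun i =>
    continuous_iff_continuousAt.2 fun x => (hg i x).continuousAt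
  -- The points `a + d n` approach `a` along `τ`. Moving each by `o(1 / c n)`, into the relative
  -- interior of a set where the minimum is a single `g i`, makes it a point of differentiability.
  obtain ⟨c, d, hd, hdS, hcd⟩ :=
    mem_tangentConeAt_iff_exists_seq.1 (h.mem_posTangentConeAt ha hτ)
  obtain ⟨N, hN⟩ := eventually_atTop.1 hdS
  have hε : ∀ n : ℕ, 0 < 1 / ((n : ℝ) + 1) / ((c n : ℝ) + 1) := fun n => by positivity
  choose y hyS hyd i hi using fun n : ℕ =>
    exists_eventually_eq_iInf h.isClosed hgc (hN (n + N) (Nat.le_add_left N n)) (hε (n + N))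
  obtain ⟨j, φ, hφ, hj⟩ := exists_strictMono_comp_eq_const i
  -- the perturbed sequence has the same limit direction
  have hshift : Tendsto (fun n => φ n + N) atTop atTop :=
    (tendsto_add_atTop_nat N).comp hφ.tendsto_atTop
  have hone : Tendsto (fun n => 1 / (((φ n + N : ℕ) : ℝ) + 1)) atTop (𝓝 0) :=
    tendsto_one_div_add_atTop_nhds_zero_nat.comp hshift
  have he : Tendsto (fun n => (c (φ n + N) : ℝ) • (y (φ n) - a)) atTop (𝓝 τ) := by
    have h1 : Tendsto (fun n => (c (φ n + N) : ℝ) • (y (φ n) - (a + d (φ n + N)))) atTop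
        (𝓝 0) := by
      refine squeeze_zero_norm (fun n => ?_) hone
      have hc : (0 : ℝ) ≤ c (φ n + N) := (c _).coe_nonneg
      have h2 := (hyd (φ n)).le
      rw [dist_eq_norm, le_div_iff₀ (by positivity)] at h2
      rw [norm_smul, Real.norm_of_nonneg hc]
      nlinarith [norm_nonneg (y (φ n) - (a + d (φ n + N)))]
    have h3 := (hcd.comp hshift).add h1
    rw [add_zero] at h3
    refine h3.congr fun n => ?_
    simp only [Function.comp_apply, NNReal.smul_def]
    rw [← smul_add]
    congr 1
    abel
  have hy0 : Tendsto (fun n => y (φ n) - a) atTop (𝓝 0) := by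
    have h1 : Tendsto (fun n => y (φ n) - (a + d (φ n + N))) atTop (𝓝 0) := by
      refine squeeze_zero_norm (fun n => ?_) hone
      rw [← dist_eq_norm]
      refine (hyd (φ n)).le.trans (div_le_self (by positivity) ?_)
      linarith [(c (φ n + N)).coe_nonneg]
    have h3 := (hd.comp hshift).add h1
    rw [add_zero] at h3
    refine h3.congr fun n => ?_
    simp only [Function.comp_apply]
    abel
  have hy : Tendsto (fun n => y (φ n)) atTop (𝓝 a) := by
    simpa using hy0.add_const a
  have hj' : ∀ n, ∀ᶠ z in 𝓝[S] (y (φ n)), ⨅ k, g k z = g j z := fun n => by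
    have := hi (φ n)
    rwa [hj n] at this
  have hact : ∀ n, ⨅ k, g k (y (φ n)) = g j (y (φ n)) := fun n =>
    (hj' n).self_of_nhdsWithin (hyS _)
  have hactA : ⨅ k, g k a = g j a :=
    tendsto_nhds_unique (((continuous_iInf_of_finite hgc).tendsto a).comp hy)
      ((((hgc j).tendsto a).comp hy).congr fun n => (hact n).symm)
  refine ⟨(F' a).ker.starProjection (g' j a), ⟨fun n => y (φ n),
    fun n => (F' (y (φ n))).ker.starProjection (g' j (y (φ n))), fun n => ⟨hyS _, ?_⟩, hy,
    h.tendsto_starProjection ha hy (((hg' j).tendsto a).comp hy)⟩, fun k hk => ?_⟩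
  · obtain ⟨h1, h2⟩ := h.hasTangentialGradientAt_starProjection (hyS (φ n)) (hg j (y (φ n)))
    exact ⟨h1, h2.congr_of_eventuallyEq_of_mem (hj' n) (hyS _)⟩
  · have hlim : ∀ l, Tendsto (fun n => (c (φ n + N) : ℝ) • (g l (y (φ n)) - g l a)) atTop
        (𝓝 (inner ℝ (g' l a) τ)) := fun l => by
      have := (hg l a).hasFDerivAt.hasFDerivWithinAt (s := Set.univ) |>.lim hy0 (by simp) he
      simpa using this
    have hpj : inner ℝ ((F' a).ker.starProjection (g' j a)) τ = inner ℝ (g' j a) τ := by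
      have := (F' a).ker.starProjection_inner_eq_zero (g' j a) τ hτ
      rw [inner_sub_left] at this
      linarith
    rw [hpj]
    refine le_of_tendsto_of_tendsto' (hlim j) (hlim k) fun n => ?_
    refine smul_le_smul_of_nonneg_left ?_ (c _).coe_nonneg
    rw [← hact n, hk, hactA]
    exact sub_le_sub_right (ciInf_le (Set.finite_range fun k => g k (y (φ n))).bddBelow k) _

/-- A point of a regular level set is Clarke critical for a minimum of smooth functions if and
only if some convex combination of the active gradients is normal to the level set. -/
theorem isClarkeCritical_iInf_iff (h : IsRegularLevelSet S F F')
    (hg : ∀ i x, HasGradientAt (g i) (g' i x) x) (hg' : ∀ i, Continuous (g' i)) {a : E}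
    (ha : a ∈ S) :
    IsClarkeCritical S (fun x => ⨅ i, g i x) a ↔
      ∃ v ∈ convexHull ℝ ((fun i => g' i a) '' {i | g i a = ⨅ j, g j a}),
        ∀ τ, F' a τ = 0 → inner ℝ v τ = 0 := by
  set A := (fun i => g' i a) '' {i | g i a = ⨅ j, g j a} with hA
  set P := (F' a).ker.starProjection with hP
  have hsub : limitingGradients S (fun x => ⨅ i, g i x) a ⊆ P '' A := fun w hw => by
    obtain ⟨i, hi, rfl⟩ := h.eq_starProjection_of_mem_limitingGradients hg hg' ha hw
    exact ⟨_, ⟨i, hi, rfl⟩, rfl⟩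
  constructor
  · intro h0
    have h1 := convexHull_mono hsub h0
    rw [← ContinuousLinearMap.coe_coe, ← LinearMap.image_convexHull] at h1
    obtain ⟨v, hv, hv0⟩ := h1
    refine ⟨v, hv, fun τ hτ => ?_⟩
    have := (F' a).ker.starProjection_inner_eq_zero v τ hτ
    rw [show (F' a).ker.starProjection v = 0 from hv0, sub_zero] at this
    exact this
  · rintro ⟨v, hv, hv0⟩
    by_contra hcrit
    have hfin : (limitingGradients S (fun x => ⨅ i, g i x) a).Finite :=
      (((Set.toFinite _).image _).image _).subset hsub
    obtain ⟨f, u, hf0, hf⟩ := geometric_hahn_banach_point_closed (convex_convexHull ℝ _)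
      (hfin.isClosed_convexHull ℝ) hcrit
    rw [map_zero] at hf0
    let τ := P ((InnerProductSpace.toDual ℝ E).symm f)
    have hτ : F' a τ = 0 := Submodule.starProjection_apply_mem (F' a).ker _
    obtain ⟨w, hw, hwmin⟩ := h.exists_mem_limitingGradients hg hg' ha hτ
    have hwτ : inner ℝ w τ = f w := by
      obtain ⟨z, -, rfl⟩ := hsub hw
      have hz : P (P z) = P z :=
        Submodule.starProjection_eq_self_iff.2 (Submodule.starProjection_apply_mem _ _)
      rw [← Submodule.inner_starProjection_left_eq_right, ← hP, hz, real_inner_comm,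
        InnerProductSpace.toDual_symm_apply]
    have hpos : 0 < inner ℝ w τ := by
      rw [hwτ]
      exact hf0.trans (hf w (subset_convexHull ℝ _ hw))
    have hconv : A ⊆ {z | inner ℝ w τ ≤ inner ℝ z τ} := by
      rintro _ ⟨j, hj, rfl⟩
      exact hwmin j hj
    have hhalf : Convex ℝ {z : E | inner ℝ w τ ≤ inner ℝ z τ} := by
      refine convex_halfSpace_ge (f := fun z : E => inner ℝ z τ) ?_ _
      exact ⟨fun x y => inner_add_left x y τ, fun c x => by simp [inner_smul_left]⟩
    have := convexHull_min hconv hhalf hv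
    rw [Set.mem_ofPred, hv0 τ hτ] at this
    exact absurd this (not_le.2 hpos)

end IsRegularLevelSet

namespace SpiderMechanism

variable {n : ℕ} (M : SpiderMechanism n)

/-! ### The spider space as a level set -/

/-- The linear part of the affine map `ξ ↦ M.node ξ i j`. -/
def nodeDeriv (i : Fin n) (j : ℕ) : M.Ambient →L[ℝ] Plane :=
  if j = 0 then 0
  else if h : j - 1 < M.numEdges i - 1 then PiLp.proj 2 _ (some ⟨i, ⟨j - 1, h⟩⟩)
  else PiLp.proj 2 _ none

@[simp]
theorem nodeDeriv_zero (i : Fin n) : M.nodeDeriv i 0 = 0 := by simp [nodeDeriv]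

theorem nodeDeriv_succ_of_lt (i : Fin n) {j : ℕ} (h : j < M.numEdges i - 1) (τ : M.Ambient) :
    M.nodeDeriv i (j + 1) τ = τ (some ⟨i, ⟨j, h⟩⟩) := by
  simp [nodeDeriv, h]

theorem nodeDeriv_succ_of_le (i : Fin n) {j : ℕ} (h : M.numEdges i - 1 ≤ j) (τ : M.Ambient) :
    M.nodeDeriv i (j + 1) τ = τ none := by
  simp [nodeDeriv, not_lt.2 h]

theorem hasStrictFDerivAt_node (i : Fin n) (j : ℕ) (ξ : M.Ambient) :
    HasStrictFDerivAt (fun ξ => M.node ξ i j) (M.nodeDeriv i j) ξ := by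
  unfold node nodeDeriv body
  split_ifs with h h'
  · exact hasStrictFDerivAt_const _ _
  · exact (PiLp.proj 2 (𝕜 := ℝ) (fun _ => Plane) _).hasStrictFDerivAt
  · exact (PiLp.proj 2 (𝕜 := ℝ) (fun _ => Plane) _).hasStrictFDerivAt

/-- The `j`-th edge of the leg `i`, as a vector directed from the foot to the body. -/
def edge (ξ : M.Ambient) (i : Fin n) (j : Fin (M.numEdges i)) : Plane :=
  M.node ξ i (j + 1) - M.node ξ i j

/-- The differential of `ξ ↦ M.edge ξ i j`. -/
def edgeDeriv (i : Fin n) (j : Fin (M.numEdges i)) : M.Ambient →L[ℝ] Plane :=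
  M.nodeDeriv i (j + 1) - M.nodeDeriv i j

theorem hasStrictFDerivAt_edge (i : Fin n) (j : Fin (M.numEdges i)) (ξ : M.Ambient) :
    HasStrictFDerivAt (fun ξ => M.edge ξ i j) (M.edgeDeriv i j) ξ :=
  (M.hasStrictFDerivAt_node i (j + 1) ξ).sub (M.hasStrictFDerivAt_node i j ξ)

/-- The squared edge lengths of a configuration. -/
def sqLengths (ξ : M.Ambient) (e : Σ i : Fin n, Fin (M.numEdges i)) : ℝ :=
  ‖M.edge ξ e.1 e.2‖ ^ 2

/-- The differential of the squared edge lengths. -/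
def sqLengthsDeriv (ξ : M.Ambient) : M.Ambient →L[ℝ] (Σ i : Fin n, Fin (M.numEdges i)) → ℝ :=
  ContinuousLinearMap.pi fun e =>
    2 • (innerSL ℝ (M.edge ξ e.1 e.2)).comp (M.edgeDeriv e.1 e.2)

theorem sqLengthsDeriv_apply (ξ τ : M.Ambient) (e : Σ i : Fin n, Fin (M.numEdges i)) :
    M.sqLengthsDeriv ξ τ e = 2 * inner ℝ (M.edge ξ e.1 e.2) (M.edgeDeriv e.1 e.2 τ) := by
  simp [sqLengthsDeriv]

theorem hasStrictFDerivAt_sqLengths (ξ : M.Ambient) :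
    HasStrictFDerivAt M.sqLengths (M.sqLengthsDeriv ξ) ξ :=
  hasStrictFDerivAt_pi.2 fun e =>
    ((hasStrictFDerivAt_norm_sq _).comp ξ (M.hasStrictFDerivAt_edge e.1 e.2 ξ))

theorem continuous_node (i : Fin n) (j : ℕ) : Continuous fun ξ : M.Ambient => M.node ξ i j := by
  unfold node body
  split_ifs
  · exact continuous_const
  · exact (PiLp.proj 2 (𝕜 := ℝ) (fun _ => Plane) _).continuous
  · exact (PiLp.proj 2 (𝕜 := ℝ) (fun _ => Plane) _).continuous

theorem continuous_edge (i : Fin n) (j : Fin (M.numEdges i)) :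
    Continuous fun ξ : M.Ambient => M.edge ξ i j :=
  (M.continuous_node i (j + 1)).sub (M.continuous_node i j)

theorem continuous_sqLengthsDeriv : Continuous M.sqLengthsDeriv := by
  refine continuous_clm_apply.2 fun τ => continuous_pi fun e => ?_
  simp only [sqLengthsDeriv_apply]
  exact continuous_const.mul ((M.continuous_edge e.1 e.2).inner continuous_const)

variable {M}

theorem mem_spiderSpace_iff {ξ : M.Ambient} :
    ξ ∈ M.spiderSpace ↔ ∀ i j, ‖M.edge ξ i j‖ = M.length i j := by
  simp only [spiderSpace, edge, dist_eq_norm', Set.mem_ofPred]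

theorem edge_ne_zero {ξ : M.Ambient} (hξ : ξ ∈ M.spiderSpace) (i : Fin n)
    (j : Fin (M.numEdges i)) : M.edge ξ i j ≠ 0 := by
  rw [← norm_pos_iff, mem_spiderSpace_iff.1 hξ]
  exact M.length_pos i j

theorem mem_spiderSpace_iff_sqLengths {ξ η : M.Ambient} (hξ : ξ ∈ M.spiderSpace) :
    η ∈ M.spiderSpace ↔ M.sqLengths η = M.sqLengths ξ := by
  rw [mem_spiderSpace_iff] at *
  refine ⟨fun h => ?_, fun h i j => ?_⟩
  · ext e
    rw [sqLengths, sqLengths, h, hξ]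
  · rw [← hξ i j]
    exact (sq_eq_sq₀ (norm_nonneg _) (norm_nonneg _)).1 (congrFun h ⟨i, j⟩)

theorem node_zero (ξ : M.Ambient) (i : Fin n) : M.node ξ i 0 = M.foot i := by simp [node]

theorem node_numEdges (ξ : M.Ambient) (i : Fin n) : M.node ξ i (M.numEdges i) = M.body ξ := by
  have := M.one_lt_numEdges i
  simp [node, show M.numEdges i ≠ 0 by omega]

theorem sum_edge (ξ : M.Ambient) (i : Fin n) :
    ∑ j, M.edge ξ i j = M.body ξ - M.foot i := by
  rw [← M.node_numEdges ξ i, ← M.node_zero ξ i, ← Finset.sum_range_sub, Finset.sum_range]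
  rfl

/-! ### Stresses of legs -/

/-- `w` is a stress of the leg `i`: the force that the leg exerts on the body under edge tensions
that are in equilibrium at all joints of the leg. -/
def IsLegStress (ξ : M.Ambient) (i : Fin n) (w : Plane) : Prop :=
  ∃ c : Fin (M.numEdges i) → ℝ, ∀ j, c j • M.edge ξ i j = w

theorem IsLegStress.smul {ξ : M.Ambient} {i : Fin n} {w : Plane} (h : M.IsLegStress ξ i w)
    (t : ℝ) : M.IsLegStress ξ i (t • w) := by
  obtain ⟨c, hc⟩ := h
  exact ⟨fun j => t * c j, fun j => by rw [mul_smul, hc]⟩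

theorem isLegStress_zero (ξ : M.Ambient) (i : Fin n) : M.IsLegStress ξ i 0 :=
  ⟨0, fun j => by simp⟩

theorem IsLegStress.exists_edge_eq {ξ : M.Ambient} {i : Fin n} {w : Plane}
    (h : M.IsLegStress ξ i w) (hw : w ≠ 0) :
    ∃ t : Fin (M.numEdges i) → ℝ, ∀ j, M.edge ξ i j = t j • w := by
  obtain ⟨c, hc⟩ := h
  refine ⟨fun j => (c j)⁻¹, fun j => ?_⟩
  have hcj : c j ≠ 0 := fun h0 => hw (by rw [← hc j, h0, zero_smul])
  rw [← hc j, inv_smul_smul₀ hcj]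

theorem IsLegStress.body_sub_foot_mem_span {ξ : M.Ambient} {i : Fin n} {w : Plane}
    (h : M.IsLegStress ξ i w) (hw : w ≠ 0) :
    M.body ξ - M.foot i ∈ Submodule.span ℝ {w} := by
  obtain ⟨t, ht⟩ := h.exists_edge_eq hw
  rw [← sum_edge]
  refine Submodule.sum_mem _ fun j _ => ?_
  rw [ht j]
  exact Submodule.smul_mem _ _ (Submodule.mem_span_singleton_self w)

theorem foot_mem_legNodes (ξ : M.Ambient) (i : Fin n) : M.foot i ∈ M.legNodes ξ i :=
  ⟨0, Nat.zero_le _, node_zero ξ i⟩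

/-- A nonzero stress of a leg spans the direction of the leg. -/
theorem IsLegStress.vectorSpan_legNodes {ξ : M.Ambient} {i : Fin n} {w : Plane}
    (h : M.IsLegStress ξ i w) (hw : w ≠ 0) :
    vectorSpan ℝ (M.legNodes ξ i) = Submodule.span ℝ {w} := by
  apply le_antisymm
  · obtain ⟨t, ht⟩ := h.exists_edge_eq hw
    rw [vectorSpan_eq_span_vsub_set_right ℝ (foot_mem_legNodes ξ i), Submodule.span_le]
    rintro _ ⟨_, ⟨j, hj, rfl⟩, rfl⟩
    simp only [Set.mem_ofPred] at hj
    induction j with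
    | zero => simp [node_zero]
    | succ j ih =>
      have h1 := ih (by omega)
      have h2 : M.edge ξ i ⟨j, by omega⟩ ∈ Submodule.span ℝ {w} := by
        rw [ht]
        exact Submodule.smul_mem _ _ (Submodule.mem_span_singleton_self w)
      have := Submodule.add_mem _ h1 h2
      simpa [edge] using this
  · obtain ⟨c, hc⟩ := h
    rw [Submodule.span_singleton_le_iff_mem]
    have hp := M.one_lt_numEdges i
    rw [← hc ⟨0, by omega⟩]
    refine Submodule.smul_mem _ _ (vsub_mem_vectorSpan ℝ ⟨1, ?_, rfl⟩ ⟨0, Nat.zero_le _, rfl⟩)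
    exact hp.le

theorem isAligned_iff_exists_stress {ξ : M.Ambient} (hξ : ξ ∈ M.spiderSpace) (i : Fin n) :
    M.IsAligned ξ i ↔ ∃ w, w ≠ 0 ∧ M.IsLegStress ξ i w := by
  constructor
  · intro h
    obtain ⟨v, hv⟩ := (collinear_iff_of_mem (foot_mem_legNodes ξ i)).1 h
    have hv' : ∀ j : ℕ, j ≤ M.numEdges i → ∃ r : ℝ, M.node ξ i j = r • v +ᵥ M.foot i :=
      fun j hj => hv _ ⟨j, hj, rfl⟩
    have he : ∀ j, ∃ r : ℝ, M.edge ξ i j = r • v := fun j => by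
      obtain ⟨r, hr⟩ := hv' j j.2.le
      obtain ⟨s, hs⟩ := hv' (j + 1) j.2
      exact ⟨s - r, by rw [edge, hr, hs, sub_smul]; simp⟩
    choose t ht using he
    have htne : ∀ j, t j ≠ 0 := fun j h0 => edge_ne_zero hξ i j (by rw [ht j, h0, zero_smul])
    have hp := M.one_lt_numEdges i
    refine ⟨v, fun h0 => edge_ne_zero hξ i ⟨0, by omega⟩ (by rw [ht, h0, smul_zero]),
      fun j => (t j)⁻¹, fun j => by rw [ht j, inv_smul_smul₀ (htne j)]⟩
  · rintro ⟨w, hw, h⟩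
    rw [IsAligned, Collinear, h.vectorSpan_legNodes hw]
    exact rank_submodule_le_one_iff' _ |>.2 ⟨w, le_rfl⟩

/-- The edges of an aligned leg are multiples of one vector `w`; the signs `ε` of the coefficients
give the critical radius. -/
theorem IsAligned.exists_mem_criticalCircle {ξ : M.Ambient} (hξ : ξ ∈ M.spiderSpace) {i : Fin n}
    (h : M.IsAligned ξ i) : ∃ ε, M.body ξ ∈ M.criticalCircle i ε := by
  obtain ⟨w, hw, hs⟩ := (isAligned_iff_exists_stress hξ i).1 h
  obtain ⟨t, ht⟩ := hs.exists_edge_eq hw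
  refine ⟨fun j => if 0 ≤ t j then 1 else -1, ?_⟩
  have hl : ∀ j, (((if 0 ≤ t j then 1 else -1 : ℤˣ) : ℤ) : ℝ) * M.length i j = t j * ‖w‖ := by
    intro j
    rw [← mem_spiderSpace_iff.1 hξ i j, ht j, norm_smul, Real.norm_eq_abs]
    split_ifs with h0
    · simp [abs_of_nonneg h0]
    · simp [abs_of_neg (not_le.1 h0)]
  show ‖M.body ξ - M.foot i‖ = M.criticalRadius i _
  rw [criticalRadius, Finset.sum_congr rfl fun j _ => hl j, ← Finset.sum_mul, ← sum_edge,
    Finset.sum_congr rfl fun j _ => ht j, ← Finset.sum_smul, norm_smul, abs_mul, abs_norm,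
    Real.norm_eq_abs]

/-! ### Equilibrium of forces and regularity of the spider space -/

/-- Summation by parts along a path that starts at `0`. -/
theorem sum_inner_sub_eq {V : Type*} [NormedAddCommGroup V] [InnerProductSpace ℝ V]
    (q L : ℕ → V) (h0 : L 0 = 0) (m : ℕ) :
    ∑ j ∈ Finset.range (m + 1), inner ℝ (q j) (L (j + 1) - L j) =
      inner ℝ (q m) (L (m + 1)) - ∑ j ∈ Finset.range m, inner ℝ (q (j + 1) - q j) (L (j + 1)) := by
  induction m with
  | zero => simp [h0]
  | succ m ih =>
    rw [Finset.sum_range_succ, ih, Finset.sum_range_succ _ m]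
    simp only [inner_sub_left, inner_sub_right]
    ring

theorem sum_inner_edgeDeriv (q : Fin n → ℕ → Plane) (τ : M.Ambient) :
    ∑ e : Σ i : Fin n, Fin (M.numEdges i), inner ℝ (q e.1 e.2) (M.edgeDeriv e.1 e.2 τ) =
      inner ℝ (∑ i, q i (M.numEdges i - 1)) (τ none) -
        ∑ e : Σ i : Fin n, Fin (M.numEdges i - 1),
          inner ℝ (q e.1 (e.2 + 1) - q e.1 e.2) (τ (some e)) := by
  rw [Fintype.sum_sigma, Fintype.sum_sigma, sum_inner, ← Finset.sum_sub_distrib]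
  refine Finset.sum_congr rfl fun i _ => ?_
  have hp := M.one_lt_numEdges i
  have h1 := sum_inner_sub_eq (q i) (fun j => M.nodeDeriv i j τ) (by simp) (M.numEdges i - 1)
  rw [Nat.sub_add_cancel hp.le, Finset.sum_range, Finset.sum_range] at h1
  refine h1.trans ?_
  congr 1
  · have := M.nodeDeriv_succ_of_le i (le_refl (M.numEdges i - 1)) τ
    rw [Nat.sub_add_cancel hp.le] at this
    rw [this]
  · exact Finset.sum_congr rfl fun j _ => by rw [M.nodeDeriv_succ_of_lt i j.2]

/-- Edge tensions `μ` balance a force `c` on the body, for all virtual displacements, exactly when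
they form a stress on every leg, and these stresses add up to `c`. -/
theorem forall_inner_eq_sum_iff (ξ : M.Ambient) (μ : (Σ i : Fin n, Fin (M.numEdges i)) → ℝ)
    (c : Plane) :
    (∀ τ : M.Ambient, inner ℝ c (τ none) =
        ∑ e, μ e * inner ℝ (M.edge ξ e.1 e.2) (M.edgeDeriv e.1 e.2 τ)) ↔
      ∃ w : Fin n → Plane, (∀ i j, μ ⟨i, j⟩ • M.edge ξ i j = w i) ∧ ∑ i, w i = c := by
  let q : Fin n → ℕ → Plane := fun i j =>
    if h : j < M.numEdges i then μ ⟨i, ⟨j, h⟩⟩ • M.edge ξ i ⟨j, h⟩ else 0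
  have hq : ∀ i (j : Fin (M.numEdges i)), q i j = μ ⟨i, j⟩ • M.edge ξ i j := fun i j => by
    simp [q]
  have hsum : ∀ τ : M.Ambient,
      ∑ e, μ e * inner ℝ (M.edge ξ e.1 e.2) (M.edgeDeriv e.1 e.2 τ) =
        inner ℝ (∑ i, q i (M.numEdges i - 1)) (τ none) -
        ∑ e : Σ i : Fin n, Fin (M.numEdges i - 1),
          inner ℝ (q e.1 (e.2 + 1) - q e.1 e.2) (τ (some e)) := fun τ => by
    rw [← sum_inner_edgeDeriv]
    refine Finset.sum_congr rfl fun e _ => ?_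
    rw [hq, inner_smul_left]
    rfl
  simp only [hsum]
  constructor
  · intro h
    -- Displacing each joint by its unbalanced force, with the body fixed, makes the total
    -- work the negative of the sum of the squares of these forces, which therefore vanish.
    have h1 := h (WithLp.toLp 2 fun o =>
      o.elim 0 fun e => q e.1 (e.2 + 1) - q e.1 e.2)
    simp only [Option.elim_none, Option.elim_some, inner_zero_right, zero_sub] at h1
    have h2 := (Finset.sum_eq_zero_iff_of_nonneg fun e _ => real_inner_self_nonneg).1
      (neg_eq_zero.1 h1.symm)
    have h3 : ∀ i (j : ℕ), j < M.numEdges i → q i j = q i 0 := by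
      intro i j
      induction j with
      | zero => intro _; rfl
      | succ j ih =>
        intro hj
        rw [← ih (by omega), ← sub_eq_zero]
        exact inner_self_eq_zero.1 (h2 ⟨i, ⟨j, by omega⟩⟩ (Finset.mem_univ _))
    refine ⟨fun i => q i 0, fun i j => by rw [← hq, h3 i j j.2], ?_⟩
    have h4 : ∀ v, inner ℝ c v = inner ℝ (∑ i, q i (M.numEdges i - 1)) v := fun v => by
      have := h (WithLp.toLp 2 fun o => o.elim v fun _ => 0)
      simpa using this
    rw [ext_inner_right ℝ h4]
    exact Finset.sum_congr rfl fun i _ => by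
      rw [h3 i _ (Nat.sub_lt (by have := M.one_lt_numEdges i; omega) one_pos)]
  · rintro ⟨w, hw, rfl⟩ τ
    have h1 : ∀ i (j : ℕ), j < M.numEdges i → q i j = w i := fun i j hj => by
      rw [← hw i ⟨j, hj⟩, ← hq]
    have h2 : ∀ e : Σ i : Fin n, Fin (M.numEdges i - 1),
        inner ℝ (q e.1 (e.2 + 1) - q e.1 e.2) (τ (some e)) = 0 := fun e => by
      have := e.2.2
      rw [h1 _ _ (by omega), h1 _ _ (by omega), sub_self, inner_zero_left]
    have h3 : ∀ i, q i (M.numEdges i - 1) = w i := fun i =>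
      h1 i _ (Nat.sub_lt (by have := M.one_lt_numEdges i; omega) one_pos)
    simp only [h2, h3, Finset.sum_const_zero, sub_zero]

theorem StronglyVoronoiGeneric.eq_or_eq_of_isAligned (hM : M.StronglyVoronoiGeneric)
    {ξ : M.Ambient} (hξ : ξ ∈ M.spiderSpace) {k l i : Fin n} (hkl : k ≠ l)
    (hk : M.IsAligned ξ k) (hl : M.IsAligned ξ l) (hi : M.IsAligned ξ i) : i = k ∨ i = l := by
  by_contra! hcon
  have hsub : (({k, l, i} : Finset (Fin n)) : Set (Fin n)) ⊆ {i | M.IsAligned ξ i} := by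
    intro j hj
    simp only [Finset.coe_insert, Finset.coe_singleton, Set.mem_insert_iff,
      Set.mem_singleton_iff] at hj
    obtain rfl | rfl | rfl := hj <;> assumption
  have h3 := Set.ncard_le_ncard hsub (Set.toFinite _)
  rw [Set.ncard_coe_finset, Finset.card_eq_three.2
    ⟨k, l, i, hkl, hcon.1.symm, hcon.2.symm, rfl⟩] at h3
  have := hM.aligned_le_two ξ hξ
  omega

/-- Stresses in equilibrium vanish: at most two legs are aligned, and two are not parallel. -/
theorem StronglyVoronoiGeneric.stress_eq_zero (hM : M.StronglyVoronoiGeneric) {ξ : M.Ambient}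
    (hξ : ξ ∈ M.spiderSpace) {w : Fin n → Plane} (hw : ∀ i, M.IsLegStress ξ i (w i))
    (hsum : ∑ i, w i = 0) (k : Fin n) : w k = 0 := by
  by_contra hk
  obtain ⟨l, hlk, hl⟩ : ∃ l, l ≠ k ∧ w l ≠ 0 := by
    by_contra! hcon
    exact hk (by rwa [Fintype.sum_eq_single k hcon] at hsum)
  have hal : ∀ i, w i ≠ 0 → M.IsAligned ξ i := fun i hi =>
    (isAligned_iff_exists_stress hξ i).2 ⟨w i, hi, hw i⟩
  have hrest : ∀ i, i ≠ k ∧ i ≠ l → w i = 0 := by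
    rintro i ⟨hik, hil⟩
    by_contra hi
    exact (hM.eq_or_eq_of_isAligned hξ hlk.symm (hal k hk) (hal l hl) (hal i hi)).elim hik hil
  rw [Fintype.sum_eq_add k l hlk.symm hrest] at hsum
  refine hM.not_parallel ξ hξ k l hlk.symm (hal k hk) (hal l hl) ?_
  rw [AffineSubspace.affineSpan_parallel_iff_vectorSpan_eq_and_eq_empty_iff_eq_empty,
    (hw k).vectorSpan_legNodes hk, (hw l).vectorSpan_legNodes hl, eq_neg_of_add_eq_zero_left hsum]
  refine ⟨?_, ?_⟩
  · rw [← Set.neg_singleton, Submodule.span_neg]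
  · simp [Set.Nonempty.ne_empty ⟨_, foot_mem_legNodes ξ k⟩,
      Set.Nonempty.ne_empty ⟨_, foot_mem_legNodes ξ l⟩]

theorem dual_sqLengthsDeriv_apply (ξ : M.Ambient)
    (φ : Module.Dual ℝ ((Σ i : Fin n, Fin (M.numEdges i)) → ℝ)) (τ : M.Ambient) :
    φ (M.sqLengthsDeriv ξ τ) = ∑ e, 2 * φ (Pi.single e 1) *
      inner ℝ (M.edge ξ e.1 e.2) (M.edgeDeriv e.1 e.2 τ) := by
  classical
  rw [LinearMap.pi_apply_eq_sum_univ φ]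
  refine Finset.sum_congr rfl fun e _ => ?_
  rw [sqLengthsDeriv_apply, smul_eq_mul, mul_right_comm]
  congr 2
  congr 1
  ext e'
  simp [Pi.single_apply, eq_comm]

theorem StronglyVoronoiGeneric.isRegularLevelSet (hM : M.StronglyVoronoiGeneric) :
    IsRegularLevelSet M.spiderSpace M.sqLengths M.sqLengthsDeriv where
  hasStrictFDerivAt := M.hasStrictFDerivAt_sqLengths
  continuous_deriv := M.continuous_sqLengthsDeriv
  mem_iff ξ hξ η := mem_spiderSpace_iff_sqLengths hξ
  range_eq_top ξ hξ := by
    rw [LinearMap.range_eq_top, ← LinearMap.dualMap_injective_iff]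
    refine (injective_iff_map_eq_zero _).2 fun φ hφ => ?_
    have hφ' : ∀ τ, φ (M.sqLengthsDeriv ξ τ) = 0 := fun τ => LinearMap.congr_fun hφ τ
    have hμ := fun τ => dual_sqLengthsDeriv_apply ξ φ τ
    obtain ⟨w, hw, hsum⟩ := (forall_inner_eq_sum_iff ξ
      (fun e => 2 * φ (Pi.single e 1)) 0).1 fun τ => by
        rw [← hμ, hφ', inner_zero_left]
    have hw0 := hM.stress_eq_zero hξ (fun i => ⟨_, hw i⟩) hsum
    refine LinearMap.pi_ext' fun e => LinearMap.ext_ring ?_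
    have := hw e.1 e.2
    rw [hw0, smul_eq_zero, or_iff_left (edge_ne_zero hξ _ _)] at this
    simpa using this

/-- The force `c` on the body is normal to the spider space if and only if it is balanced by
stresses of the legs. -/
theorem forall_inner_body_eq_zero_iff (ξ : M.Ambient) (c : Plane) :
    (∀ τ, M.sqLengthsDeriv ξ τ = 0 → inner ℝ c (τ none) = 0) ↔
      ∃ w : Fin n → Plane, (∀ i, M.IsLegStress ξ i (w i)) ∧ ∑ i, w i = c := by
  constructor
  · intro h
    let K : Module.Dual ℝ M.Ambient :=
      ((innerSL ℝ c).comp (PiLp.proj 2 (𝕜 := ℝ) (fun _ => Plane) none)).toLinearMap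
    have hK : K ∈ (M.sqLengthsDeriv ξ).toLinearMap.dualMap.range := by
      rw [LinearMap.range_dualMap_eq_dualAnnihilator_ker, Submodule.mem_dualAnnihilator]
      exact fun τ hτ => h τ hτ
    obtain ⟨φ, hφ⟩ := hK
    obtain ⟨w, hw, hsum⟩ := (forall_inner_eq_sum_iff ξ
      (fun e => 2 * φ (Pi.single e 1)) c).1 fun τ => by
        rw [← dual_sqLengthsDeriv_apply]
        exact (LinearMap.congr_fun hφ τ).symm
    exact ⟨w, fun i => ⟨_, hw i⟩, hsum⟩
  · rintro ⟨w, hw, hsum⟩ τ hτ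
    choose μ hμ using hw
    rw [(forall_inner_eq_sum_iff ξ (fun e => μ e.1 e.2) c).2 ⟨w, hμ, hsum⟩ τ]
    refine Finset.sum_eq_zero fun e _ => ?_
    have := congrFun hτ e
    rw [sqLengthsDeriv_apply, Pi.zero_apply] at this
    rw [(mul_eq_zero_iff_left two_ne_zero).1 this, mul_zero]

/-! ### Criticality as an equilibrium condition -/

variable (M) in
/-- The vectors from the feet nearest to `x` to `x`; these are halves of the limits of gradients
of the squared Voronoi distance at `x`. -/
def nearestDirections (x : Plane) : Set Plane :=
  (fun i => x - M.foot i) '' {i | x ∈ M.powerCell i}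

theorem voronoiDist_le (x : Plane) (i : Fin n) : M.voronoiDist x ≤ ‖x - M.foot i‖ ^ 2 :=
  ciInf_le (Set.finite_range fun i => ‖x - M.foot i‖ ^ 2).bddBelow i

theorem mem_powerCell_iff {x : Plane} {i : Fin n} :
    x ∈ M.powerCell i ↔ ‖x - M.foot i‖ ^ 2 = M.voronoiDist x :=
  ⟨fun h => le_antisymm h (voronoiDist_le x i), le_of_eq⟩

theorem exists_mem_powerCell (hn : 0 < n) (x : Plane) : ∃ i, x ∈ M.powerCell i := by
  have : Nonempty (Fin n) := ⟨⟨0, hn⟩⟩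
  obtain ⟨i, hi⟩ := exists_eq_ciInf_of_finite (f := fun i => ‖x - M.foot i‖ ^ 2)
  exact ⟨i, mem_powerCell_iff.2 hi⟩

theorem sub_foot_mem_convexHull {x : Plane} {i : Fin n} (h : x ∈ M.powerCell i) :
    x - M.foot i ∈ convexHull ℝ (M.nearestDirections x) :=
  subset_convexHull ℝ _ ⟨i, h, rfl⟩

/-- The criterion for a minimum of smooth functions, for the Voronoi distance pulled back by a
linear map `B`: the identity of the plane, or the work map. -/
theorem isClarkeCritical_voronoiDist_comp_iff (hn : 0 < n) {E G : Type*} [NormedAddCommGroup E]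
    [InnerProductSpace ℝ E] [FiniteDimensional ℝ E] [CompleteSpace E] [NormedAddCommGroup G]
    [NormedSpace ℝ G] [FiniteDimensional ℝ G] {S : Set E} {F : E → G} {F' : E → E →L[ℝ] G}
    (h : IsRegularLevelSet S F F') (B : E →L[ℝ] Plane) {a : E} (ha : a ∈ S) :
    IsClarkeCritical S (fun x => M.voronoiDist (B x)) a ↔
      ∃ c ∈ convexHull ℝ (M.nearestDirections (B a)), ∀ τ, F' a τ = 0 → inner ℝ c (B τ) = 0 := by
  have : Nonempty (Fin n) := ⟨⟨0, hn⟩⟩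
  have hg : ∀ i x, HasGradientAt (fun x => ‖B x - M.foot i‖ ^ 2)
      ((2 : ℝ) • B.adjoint (B x - M.foot i)) x := fun i x => by
    have h1 := (hasStrictFDerivAt_norm_sq (B x - M.foot i)).hasFDerivAt.comp x
      (B.hasFDerivAt.sub_const (x := x) (M.foot i))
    rw [hasGradientAt_iff_hasFDerivAt]
    refine h1.congr_fderiv ?_
    ext v
    simp [ContinuousLinearMap.adjoint_inner_left]
  have hg' : ∀ i, Continuous fun x => (2 : ℝ) • B.adjoint (B x - M.foot i) := fun i =>
    ((B.adjoint.continuous.comp (B.continuous.sub continuous_const))).const_smul 2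
  refine (h.isClarkeCritical_iInf_iff hg hg' ha).trans ?_
  have himage : (fun i => (2 : ℝ) • B.adjoint (B a - M.foot i)) ''
      {i | ‖B a - M.foot i‖ ^ 2 = ⨅ j, ‖B a - M.foot j‖ ^ 2} =
      ((2 : ℝ) • B.adjoint).toLinearMap '' M.nearestDirections (B a) := by
    rw [nearestDirections, Set.image_image]
    congr 1
    ext i
    exact mem_powerCell_iff.symm
  rw [himage, ← LinearMap.image_convexHull, Set.exists_mem_image]
  refine exists_congr fun c => and_congr_right fun _ => forall₂_congr fun τ _ => ?_
  simp [inner_smul_left, ContinuousLinearMap.adjoint_inner_left]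

/-- The whole space is a level set of the map to a point. -/
theorem isRegularLevelSet_univ (E : Type*) [NormedAddCommGroup E] [NormedSpace ℝ E] :
    IsRegularLevelSet (Set.univ : Set E) (fun _ => (0 : Fin 0 → ℝ)) 0 where
  hasStrictFDerivAt _ := hasStrictFDerivAt_const _ _
  continuous_deriv := continuous_const
  range_eq_top _ _ := Subsingleton.elim _ _
  mem_iff _ _ _ := by simp

theorem isVoronoiCritical_iff (hn : 0 < n) (x : Plane) :
    M.IsVoronoiCritical x ↔ 0 ∈ convexHull ℝ (M.nearestDirections x) := by
  refine (isClarkeCritical_voronoiDist_comp_iff hn (isRegularLevelSet_univ Plane)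
    (ContinuousLinearMap.id ℝ Plane) (Set.mem_univ x)).trans ⟨?_, fun h => ⟨0, h, by simp⟩⟩
  rintro ⟨c, hc, h⟩
  have h0 : c = 0 := inner_self_eq_zero.1 (h c rfl)
  exact h0 ▸ hc

/-- A configuration is critical if and only if the legs can balance some convex combination of the
forces with which the nearest feet repel the body. -/
theorem StronglyVoronoiGeneric.isLiftedVoronoiCritical_iff (hM : M.StronglyVoronoiGeneric)
    (hn : 0 < n) {ξ : M.Ambient} (hξ : ξ ∈ M.spiderSpace) :
    M.IsLiftedVoronoiCritical ξ ↔ ∃ w : Fin n → Plane, (∀ i, M.IsLegStress ξ i (w i)) ∧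
      ∑ i, w i ∈ convexHull ℝ (M.nearestDirections (M.body ξ)) := by
  refine (isClarkeCritical_voronoiDist_comp_iff hn hM.isRegularLevelSet
    (PiLp.proj 2 (𝕜 := ℝ) (fun _ => Plane) none) hξ).trans ?_
  constructor
  · rintro ⟨c, hc, h⟩
    obtain ⟨w, hw, rfl⟩ := (forall_inner_body_eq_zero_iff ξ c).1 h
    exact ⟨w, hw, hc⟩
  · rintro ⟨w, hw, hc⟩
    exact ⟨_, hc, (forall_inner_body_eq_zero_iff ξ _).2 ⟨w, hw, rfl⟩⟩

theorem IsLegStress.eq_zero {ξ : M.Ambient} (hξ : ξ ∈ M.spiderSpace) {i : Fin n} {w : Plane}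
    (h : M.IsLegStress ξ i w) (hi : ¬ M.IsAligned ξ i) : w = 0 := by
  by_contra hw
  exact hi ((isAligned_iff_exists_stress hξ i).2 ⟨w, hw, h⟩)

theorem StronglyVoronoiGeneric.isLiftedVoronoiCritical_iff_of_forall_not_isAligned
    (hM : M.StronglyVoronoiGeneric) (hn : 0 < n) {ξ : M.Ambient} (hξ : ξ ∈ M.spiderSpace)
    (hal : ∀ i, ¬ M.IsAligned ξ i) :
    M.IsLiftedVoronoiCritical ξ ↔ M.IsVoronoiCritical (M.body ξ) := by
  rw [hM.isLiftedVoronoiCritical_iff hn hξ, isVoronoiCritical_iff hn]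
  constructor
  · rintro ⟨w, hw, hc⟩
    rwa [Finset.sum_eq_zero fun i _ => (hw i).eq_zero hξ (hal i)] at hc
  · intro h
    exact ⟨0, fun i => isLegStress_zero ξ i, by simpa using h⟩

/-- Stresses along two directions that are not parallel balance every force. -/
theorem StronglyVoronoiGeneric.isLiftedVoronoiCritical_of_isAligned
    (hM : M.StronglyVoronoiGeneric) (hn : 0 < n) {ξ : M.Ambient} (hξ : ξ ∈ M.spiderSpace)
    {k l : Fin n} (hkl : k ≠ l) (hk : M.IsAligned ξ k) (hl : M.IsAligned ξ l) :
    M.IsLiftedVoronoiCritical ξ := by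
  obtain ⟨u, hu, hku⟩ := (isAligned_iff_exists_stress hξ k).1 hk
  obtain ⟨v, hv, hlv⟩ := (isAligned_iff_exists_stress hξ l).1 hl
  have hli : LinearIndependent ℝ ![u, v] := by
    rw [LinearIndependent.pair_iff]
    intro s t hst
    let w : Fin n → Plane := Pi.single k (s • u) + Pi.single l (t • v)
    have hw : ∀ i, M.IsLegStress ξ i (w i) := by
      intro i
      by_cases hik : i = k
      · subst hik
        simpa [w, hkl] using hku.smul s
      by_cases hil : i = l
      · subst hil
        simpa [w, hik] using hlv.smul t
      simpa [w, hik, hil] using isLegStress_zero ξ i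
    have hsum : ∑ i, w i = 0 := by
      simp [w, Finset.sum_add_distrib, hst]
    have h0 := hM.stress_eq_zero hξ hw hsum
    have h1 := h0 k
    have h2 := h0 l
    simp only [w, Pi.add_apply, Pi.single_eq_same, Pi.single_eq_of_ne hkl, add_zero] at h1
    simp only [w, Pi.add_apply, Pi.single_eq_same, Pi.single_eq_of_ne hkl.symm, zero_add] at h2
    exact ⟨(smul_eq_zero.1 h1).resolve_right hu, (smul_eq_zero.1 h2).resolve_right hv⟩
  obtain ⟨j, hj⟩ := exists_mem_powerCell (M := M) hn (M.body ξ)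
  have hspan : M.body ξ - M.foot j ∈ Submodule.span ℝ {u, v} := by
    have := hli.span_eq_top_of_card_eq_finrank (by simp)
    rw [Matrix.range_cons, Matrix.range_cons, Matrix.range_empty, Set.union_empty,
      Set.singleton_union] at this
    rw [this]
    trivial
  obtain ⟨s, t, hst⟩ := Submodule.mem_span_pair.1 hspan
  refine (hM.isLiftedVoronoiCritical_iff hn hξ).2
    ⟨Pi.single k (s • u) + Pi.single l (t • v), fun i => ?_, ?_⟩
  · by_cases hik : i = k
    · subst hik
      simpa [hkl] using hku.smul s
    by_cases hil : i = l
    · subst hil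
      simpa [hik] using hlv.smul t
    simpa [hik, hil] using isLegStress_zero ξ i
  · simpa [Finset.sum_add_distrib, hst] using sub_foot_mem_convexHull hj

/-! ### Configurations with one aligned leg -/

/-- The body lies on a critical circle of the aligned leg, so it is not critical for the Voronoi
distance. -/
theorem StronglyVoronoiGeneric.zero_notMem_convexHull (hM : M.StronglyVoronoiGeneric) (hn : 0 < n)
    {ξ : M.Ambient} (hξ : ξ ∈ M.spiderSpace) {k : Fin n} (hk : M.IsAligned ξ k) :
    (0 : Plane) ∉ convexHull ℝ (M.nearestDirections (M.body ξ)) := fun h0 => by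
  obtain ⟨ε, hε⟩ := hk.exists_mem_criticalCircle hξ
  exact hM.critical_notMem_circle _ ((isVoronoiCritical_iff hn _).2 h0) k ε hε

/-- A foot is a critical point of the Voronoi distance; so the body does not sit on the foot of an
aligned leg. -/
theorem body_ne_foot {ξ : M.Ambient}
    (h0 : (0 : Plane) ∉ convexHull ℝ (M.nearestDirections (M.body ξ))) (k : Fin n) (hn : 0 < n) :
    M.body ξ - M.foot k ≠ 0 := fun h => by
  have : Nonempty (Fin n) := ⟨⟨0, hn⟩⟩
  refine h0 ?_
  rw [← h]
  refine sub_foot_mem_convexHull (mem_powerCell_iff.2 (le_antisymm ?_ (voronoiDist_le _ _)))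
  rw [h, norm_zero, zero_pow two_ne_zero]
  exact le_ciInf fun i => sq_nonneg _

/-- All stresses of an aligned leg are multiples of the vector from its foot to the body. -/
theorem isLegStress_iff_mem_span {ξ : M.Ambient} (hξ : ξ ∈ M.spiderSpace) {k : Fin n}
    (hk : M.IsAligned ξ k) (hne : M.body ξ - M.foot k ≠ 0) (c : Plane) :
    M.IsLegStress ξ k c ↔ c ∈ Submodule.span ℝ {M.body ξ - M.foot k} := by
  have key : ∀ w, w ≠ 0 → M.IsLegStress ξ k w → ∃ t : ℝ, w = t • (M.body ξ - M.foot k) :=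
    fun w hw h => by
      obtain ⟨r, hr⟩ := Submodule.mem_span_singleton.1 (h.body_sub_foot_mem_span hw)
      refine ⟨r⁻¹, ?_⟩
      rw [← hr, inv_smul_smul₀]
      rintro rfl
      exact hne (by rw [← hr, zero_smul])
  constructor
  · intro h
    by_cases hc : c = 0
    · simp [hc]
    obtain ⟨t, rfl⟩ := key c hc h
    exact Submodule.smul_mem _ _ (Submodule.mem_span_singleton_self _)
  · intro h
    obtain ⟨t, rfl⟩ := Submodule.mem_span_singleton.1 h
    obtain ⟨w, hw, hs⟩ := (isAligned_iff_exists_stress hξ k).1 hk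
    obtain ⟨r, hr⟩ := Submodule.mem_span_singleton.1 (hs.body_sub_foot_mem_span hw)
    rw [← hr]
    exact (hs.smul r).smul t

theorem StronglyVoronoiGeneric.isLiftedVoronoiCritical_iff_of_isAligned_iff
    (hM : M.StronglyVoronoiGeneric) (hn : 0 < n) {ξ : M.Ambient} (hξ : ξ ∈ M.spiderSpace)
    {k : Fin n} (hk : ∀ i, M.IsAligned ξ i ↔ i = k) :
    M.IsLiftedVoronoiCritical ξ ↔ ∃ c ∈ convexHull ℝ (M.nearestDirections (M.body ξ)),
      c ∈ Submodule.span ℝ {M.body ξ - M.foot k} := by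
  have hk' := (hk k).2 rfl
  have hst := isLegStress_iff_mem_span hξ hk'
    (body_ne_foot (hM.zero_notMem_convexHull hn hξ hk') k hn)
  rw [hM.isLiftedVoronoiCritical_iff hn hξ]
  constructor
  · rintro ⟨w, hw, hc⟩
    rw [Fintype.sum_eq_single k fun i hi => (hw i).eq_zero hξ (mt (hk i).1 hi)] at hc
    exact ⟨w k, hc, (hst _).1 (hw k)⟩
  · rintro ⟨c, hc, hck⟩
    refine ⟨Pi.single k c, fun i => ?_, by simpa using hc⟩
    obtain rfl | hi := eq_or_ne i k
    · simpa using (hst c).2 hck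
    · simpa [hi] using isLegStress_zero ξ i

end SpiderMechanism

/-! ### Lines and double cones in the plane -/

/-- In the plane, every line through the origin is the kernel of a linear functional. -/
theorem exists_linearMap_eq_zero_iff_mem_span {u : Plane} (hu : u ≠ 0) :
    ∃ ψ : Plane →ₗ[ℝ] ℝ, ∀ v, ψ v = 0 ↔ v ∈ Submodule.span ℝ {u} := by
  refine ⟨{ toFun := fun v => u 0 * v 1 - u 1 * v 0
            map_add' := fun v w => by simp only [PiLp.add_apply]; ring
            map_smul' := fun c v => by
              simp only [PiLp.smul_apply, smul_eq_mul, RingHom.id_apply]; ring },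
    fun v => ?_⟩
  show u 0 * v 1 - u 1 * v 0 = 0 ↔ _
  rw [Submodule.mem_span_singleton]
  constructor
  · intro h
    by_cases h0 : u 0 = 0
    · have h1 : u 1 ≠ 0 := fun h1 => hu (by ext i; fin_cases i <;> simp [h0, h1])
      refine ⟨v 1 / u 1, ?_⟩
      ext i
      fin_cases i
      · simp only [Fin.zero_eta, PiLp.smul_apply, smul_eq_mul]
        field_simp
        linarith
      · simp [h1]
    · refine ⟨v 0 / u 0, ?_⟩
      ext i
      fin_cases i
      · simp [h0]
      · simp only [Fin.mk_one, PiLp.smul_apply, smul_eq_mul]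
        field_simp
        linarith
  · rintro ⟨a, rfl⟩
    simp only [PiLp.smul_apply, smul_eq_mul]
    ring

namespace SpiderMechanism

variable {n : ℕ} {M : SpiderMechanism n}

/-- A point off the Voronoi diagram is strictly nearer to its nearest foot than to all others. -/
theorem mem_interior_powerCell {x : Plane} {i : Fin n} (hi : x ∈ M.powerCell i)
    (hx : x ∉ M.voronoiDiagram) : x ∈ interior (M.powerCell i) := by
  have : Nonempty (Fin n) := ⟨i⟩
  have h : ∀ j, ∀ᶠ y in 𝓝 x, ‖y - M.foot i‖ ^ 2 ≤ ‖y - M.foot j‖ ^ 2 := fun j => by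
    obtain rfl | hij := eq_or_ne i j
    · exact Eventually.of_forall fun y => le_rfl
    have hlt : ‖x - M.foot i‖ ^ 2 < ‖x - M.foot j‖ ^ 2 := by
      rw [mem_powerCell_iff.1 hi]
      refine lt_of_le_of_ne (voronoiDist_le x j) fun hj => hx ?_
      exact ⟨i, j, hij, (mem_powerCell_iff.1 hi).symm, hj⟩
    have hc : ∀ l, ContinuousAt (fun y => ‖y - M.foot l‖ ^ 2) x := fun l => by fun_prop
    filter_upwards [(hc i).eventually_lt (hc j) hlt] with y hy using hy.le
  rw [mem_interior_iff_mem_nhds]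
  filter_upwards [eventually_all.2 h] with y hy using le_ciInf hy

theorem inv_smul_add_mem_convexHull {x : Plane} {i j : Fin n} (hi : x ∈ M.powerCell i)
    (hj : x ∈ M.powerCell j) {s t : ℝ} (hs : 0 ≤ s) (ht : 0 ≤ t) (hst : 0 < s + t) :
    (s + t)⁻¹ • (s • (x - M.foot i) + t • (x - M.foot j)) ∈
      convexHull ℝ (M.nearestDirections x) := by
  rw [smul_add, smul_smul, smul_smul]
  refine convex_convexHull ℝ _ (sub_foot_mem_convexHull hi) (sub_foot_mem_convexHull hj)
    (by positivity) (by positivity) ?_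
  rw [← mul_add, inv_mul_cancel₀ hst.ne']

/-- If the line through `x` and `p` meets the convex hull of the nearest feet, it separates two of
them weakly, and so runs inside their double cone. -/
theorem exists_line_subset_doubleCone {x p c : Plane} (hx : x ∈ M.voronoiDiagram) (hp : x - p ≠ 0)
    (h0 : (0 : Plane) ∉ convexHull ℝ (M.nearestDirections x))
    (hc : c ∈ convexHull ℝ (M.nearestDirections x)) (hcp : c ∈ Submodule.span ℝ {x - p}) :
    ∃ i j, i ≠ j ∧ x ∈ M.powerCell i ∩ M.powerCell j ∧
      (line[ℝ, x, p] : Set Plane) ⊆ doubleCone x (M.foot i) (M.foot j) := by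
  obtain ⟨ψ, hψ⟩ := exists_linearMap_eq_zero_iff_mem_span hp
  have hc0 := (hψ c).2 hcp
  obtain ⟨i, hi, hile⟩ : ∃ i, x ∈ M.powerCell i ∧ ψ (x - M.foot i) ≤ 0 := by
    by_contra! hcon
    have hsub : M.nearestDirections x ⊆ {v | 0 < ψ v} := by
      rintro _ ⟨i, hi, rfl⟩
      exact hcon i hi
    exact (convexHull_min hsub (convex_halfSpace_gt ψ.isLinear 0) hc).ne' hc0
  obtain ⟨j, hj, hjle⟩ : ∃ j, x ∈ M.powerCell j ∧ 0 ≤ ψ (x - M.foot j) := by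
    by_contra! hcon
    have hsub : M.nearestDirections x ⊆ {v | ψ v < 0} := by
      rintro _ ⟨i, hi, rfl⟩
      exact hcon i hi
    exact (convexHull_min hsub (convex_halfSpace_lt ψ.isLinear 0) hc).ne hc0
  -- The two feet coincide only if they lie on the line; then any other nearest foot will do.
  obtain ⟨i, j, hij, hi, hj, hile, hjle⟩ : ∃ i j, i ≠ j ∧ x ∈ M.powerCell i ∧
      x ∈ M.powerCell j ∧ ψ (x - M.foot i) ≤ 0 ∧ 0 ≤ ψ (x - M.foot j) := by
    by_cases hij : i = j
    · subst hij
      obtain ⟨l, hli, hl⟩ : ∃ l, l ≠ i ∧ x ∈ M.powerCell l := by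
        obtain ⟨a, b, hab, ha, hb⟩ := hx
        by_cases hai : a = i
        · exact ⟨b, fun hb => hab (hai.trans hb.symm), hb.ge⟩
        · exact ⟨a, hai, ha.ge⟩
      rcases le_total 0 (ψ (x - M.foot l)) with h | h
      · exact ⟨i, l, hli.symm, hi, hl, hile, h⟩
      · exact ⟨l, i, hli, hl, hi, h, hjle⟩
    · exact ⟨i, j, hij, hi, hj, hile, hjle⟩
  refine ⟨i, j, hij, ⟨hi, hj⟩, ?_⟩
  obtain ⟨s, t, hs, ht, hst, hmem⟩ : ∃ s t : ℝ, 0 ≤ s ∧ 0 ≤ t ∧ 0 < s + t ∧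
      s • (x - M.foot i) + t • (x - M.foot j) ∈ Submodule.span ℝ {x - p} := by
    by_cases hz : ψ (x - M.foot i) = 0
    -- the foot `i` lies on the line itself
    · exact ⟨1, 0, zero_le_one, le_rfl, by norm_num, by simpa using (hψ _).1 hz⟩
    · have := lt_of_le_of_ne hile hz
      refine ⟨ψ (x - M.foot j), -ψ (x - M.foot i), hjle, by linarith, by linarith,
        (hψ _).1 ?_⟩
      rw [map_add, map_smul, map_smul, smul_eq_mul, smul_eq_mul]
      ring
  obtain ⟨ρ, hρ⟩ := Submodule.mem_span_singleton.1 hmem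
  have hρ0 : ρ ≠ 0 := by
    rintro rfl
    have := inv_smul_add_mem_convexHull hi hj hs ht hst
    rw [← hρ, zero_smul, smul_zero] at this
    exact h0 this
  intro y hy
  obtain ⟨r, rfl⟩ := mem_affineSpan_pair_iff_exists_lineMap_eq.1 hy
  have hyx : AffineMap.lineMap x p r - x =
      (r / ρ * s) • (M.foot i - x) + (r / ρ * t) • (M.foot j - x) := by
    have : (r / ρ * s) • (M.foot i - x) + (r / ρ * t) • (M.foot j - x) =
        -(r / ρ) • (s • (x - M.foot i) + t • (x - M.foot j)) := by module
    rw [this, ← hρ, smul_smul, neg_mul, div_mul_cancel₀ r hρ0, AffineMap.lineMap_apply]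
    simp only [vsub_eq_sub, vadd_eq_add]
    module
  rcases le_total 0 (r / ρ) with h | h
  · exact ⟨r / ρ * s, r / ρ * t, mul_nonneg h hs, mul_nonneg h ht, Or.inl hyx⟩
  · refine ⟨-(r / ρ) * s, -(r / ρ) * t, mul_nonneg (neg_nonneg.2 h) hs,
      mul_nonneg (neg_nonneg.2 h) ht, Or.inr ?_⟩
    rw [hyx]
    module

theorem exists_mem_convexHull_of_mem_doubleCone {x p : Plane} {i j : Fin n} (hp : x - p ≠ 0)
    (hi : x ∈ M.powerCell i) (hj : x ∈ M.powerCell j)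
    (h : p ∈ doubleCone x (M.foot i) (M.foot j)) :
    ∃ c ∈ convexHull ℝ (M.nearestDirections x), c ∈ Submodule.span ℝ {x - p} := by
  obtain ⟨s, t, hs, ht, h⟩ := h
  have hv : s • (x - M.foot i) + t • (x - M.foot j) = x - p ∨
      s • (x - M.foot i) + t • (x - M.foot j) = -(x - p) := by
    have hneg : s • (x - M.foot i) + t • (x - M.foot j) =
        -(s • (M.foot i - x) + t • (M.foot j - x)) := by module
    rcases h with h | h
    · exact Or.inl (by rw [hneg, ← h]; abel)
    · exact Or.inr (by rw [hneg, ← h]; abel)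
  have hst : 0 < s + t := by
    refine lt_of_le_of_ne (add_nonneg hs ht) fun h0 => hp ?_
    have hs0 : s = 0 := by linarith
    have ht0 : t = 0 := by linarith
    subst hs0 ht0
    simpa [eq_comm, sub_eq_zero] using hv
  refine ⟨_, inv_smul_add_mem_convexHull hi hj hs ht hst, Submodule.smul_mem _ _ ?_⟩
  rcases hv with h | h
  · rw [h]
    exact Submodule.mem_span_singleton_self _
  · rw [h]
    exact Submodule.neg_mem _ (Submodule.mem_span_singleton_self _)

theorem mem_line_iff_sub_mem_span {x a b : Plane} (hb : x - b ≠ 0) (hab : a ≠ b) :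
    x ∈ line[ℝ, a, b] ↔ x - a ∈ Submodule.span ℝ {x - b} := by
  rw [mem_affineSpan_pair_iff_exists_lineMap_eq, Submodule.mem_span_singleton]
  simp only [AffineMap.lineMap_apply, vsub_eq_sub, vadd_eq_add]
  constructor
  · rintro ⟨r, rfl⟩
    have hr : r ≠ 1 := by
      rintro rfl
      exact hb (by simp)
    have hr' : r - 1 ≠ 0 := sub_ne_zero.2 hr
    refine ⟨r / (r - 1), ?_⟩
    have : r • (b - a) + a - b = (r - 1) • (b - a) := by module
    rw [this, smul_smul, div_mul_cancel₀ _ hr']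
    abel
  · rintro ⟨t, ht⟩
    have ht1 : t - 1 ≠ 0 := by
      rw [sub_ne_zero]
      rintro rfl
      rw [one_smul] at ht
      exact hab (sub_right_injective ht).symm
    refine ⟨t / (t - 1), ?_⟩
    have h1 : (t - 1) • (x - b) = b - a := by
      rw [sub_smul, ht]
      module
    rw [← h1, smul_smul, div_mul_cancel₀ _ ht1, ht]
    abel

end SpiderMechanism

end

open SpiderMechanism

theorem mainTheorem3 {n : ℕ} (hn : 0 < n) (M : SpiderMechanism n)
    (hM : M.StronglyVoronoiGeneric) (ξ : M.Ambient) (hξ : ξ ∈ M.spiderSpace) :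
    M.IsLiftedVoronoiCritical ξ ↔
      -- no aligned leg
      ((∀ i, ¬ M.IsAligned ξ i) ∧ M.IsVoronoiCritical (M.body ξ)) ∨
      -- exactly one aligned leg, the leg k
      (∃ k, (∀ i, M.IsAligned ξ i ↔ i = k) ∧
        ((∃ i, M.body ξ ∈ interior (M.powerCell i) ∧
            ((i ≠ k ∧ ∃ ε, M.body ξ ∈
                M.criticalCircle k ε ∩ (line[ℝ, M.foot i, M.foot k] : Set Plane) ∩ M.workSpace) ∨
              (i = k ∧ ∃ ε, M.body ξ ∈ M.criticalCircle k ε))) ∨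
          (M.body ξ ∈ M.voronoiDiagram ∧
            ∃ i j, i ≠ j ∧ M.body ξ ∈ M.powerCell i ∩ M.powerCell j ∧
              (line[ℝ, M.body ξ, M.foot k] : Set Plane) ⊆
                doubleCone (M.body ξ) (M.foot i) (M.foot j)))) ∨
      -- exactly two aligned legs, the legs k and l
      (∃ k l, k ≠ l ∧ (∀ i, M.IsAligned ξ i ↔ i = k ∨ i = l) ∧
        ∃ ε δ, M.body ξ ∈ M.criticalCircle k ε ∩ M.criticalCircle l δ) := by
  constructor
  · intro h
    by_cases h0 : ∀ i, ¬ M.IsAligned ξ i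
    · exact Or.inl
        ⟨h0, (hM.isLiftedVoronoiCritical_iff_of_forall_not_isAligned hn hξ h0).1 h⟩
    push Not at h0
    obtain ⟨k, hk⟩ := h0
    obtain ⟨ε, hε⟩ := hk.exists_mem_criticalCircle hξ
    refine Or.inr ?_
    by_cases h1 : ∃ l, l ≠ k ∧ M.IsAligned ξ l
    · obtain ⟨l, hlk, hl⟩ := h1
      obtain ⟨δ, hδ⟩ := hl.exists_mem_criticalCircle hξ
      refine Or.inr ⟨k, l, hlk.symm, fun i =>
        ⟨hM.eq_or_eq_of_isAligned hξ hlk.symm hk hl, ?_⟩, ε, δ, hε, hδ⟩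
      rintro (rfl | rfl) <;> assumption
    · push Not at h1
      have hk1 : ∀ i, M.IsAligned ξ i ↔ i = k :=
        fun i => ⟨fun hi => by_contra fun hik => h1 i hik hi, fun hik => hik ▸ hk⟩
      refine Or.inl ⟨k, hk1, ?_⟩
      have hC := hM.zero_notMem_convexHull hn hξ hk
      have hne := body_ne_foot hC k hn
      obtain ⟨c, hc, hck⟩ := (hM.isLiftedVoronoiCritical_iff_of_isAligned_iff hn hξ hk1).1 h
      by_cases hV : M.body ξ ∈ M.voronoiDiagram
      · exact Or.inr ⟨hV, exists_line_subset_doubleCone hV hne hC hc hck⟩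
      obtain ⟨i, hi⟩ := exists_mem_powerCell (M := M) hn (M.body ξ)
      refine Or.inl ⟨i, mem_interior_powerCell hi hV, ?_⟩
      obtain rfl | hik := eq_or_ne i k
      · exact Or.inr ⟨rfl, ε, hε⟩
      refine Or.inl ⟨hik, ε, ⟨hε, ?_⟩, ⟨ξ, hξ, rfl⟩⟩
      -- off the Voronoi diagram there is a single nearest foot, so `c` is known
      have hsub : M.nearestDirections (M.body ξ) ⊆ {M.body ξ - M.foot i} := by
        rintro _ ⟨j, hj, rfl⟩
        have hji : j = i := by
          by_contra hji
          exact hV ⟨j, i, hji, (mem_powerCell_iff.1 hj).symm, (mem_powerCell_iff.1 hi).symm⟩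
        rw [hji]
        rfl
      have hci := convexHull_min hsub (convex_singleton _) hc
      rw [Set.mem_singleton_iff.1 hci] at hck
      exact (mem_line_iff_sub_mem_span hne (M.foot_injective.ne hik)).2 hck
  · rintro (⟨h0, h⟩ | ⟨k, hk, h⟩ | ⟨k, l, hkl, hal, -⟩)
    · exact (hM.isLiftedVoronoiCritical_iff_of_forall_not_isAligned hn hξ h0).2 h
    · have hC := hM.zero_notMem_convexHull hn hξ ((hk k).2 rfl)
      have hne := body_ne_foot hC k hn
      refine (hM.isLiftedVoronoiCritical_iff_of_isAligned_iff hn hξ hk).2 ?_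
      rcases h with ⟨i, hi, h⟩ | ⟨-, i, j, -, ⟨hi, hj⟩, hcone⟩
      · refine ⟨_, sub_foot_mem_convexHull (interior_subset hi), ?_⟩
        rcases h with ⟨hik, ε, ⟨-, hline⟩, -⟩ | ⟨rfl, -⟩
        · exact (mem_line_iff_sub_mem_span hne (M.foot_injective.ne hik)).1 hline
        · exact Submodule.mem_span_singleton_self _
      · exact exists_mem_convexHull_of_mem_doubleCone hne hi hj
          (hcone (right_mem_affineSpan_pair ℝ _ _))
    · exact hM.isLiftedVoronoiCritical_of_isAligned hn hξ hkl ((hal k).2 (Or.inl rfl))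
        ((hal l).2 (Or.inr rfl))
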